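/- **Corollary (Geodesic curvature minimization).** Let $L>0$, let $\Phi\in C^1(\mathbb{R}^3)$ satisfy $\Phi'(p)\neq 0$ for all $p\in S:=\{\Phi=0\}$, and put $n_S=\Phi'/|\Phi'|$ (with $n_S:=0$ where $\Phi'=0$). Let $L_{bc}:H^2(0,L;\mathbb{R}^3)\to\mathbb{R}^\ell$ be bounded and linear, with $L_{bc}[v]$ depending only on the values of $v$ and $v'$ at $0$ and $L$, and let $\ell_{bc}\in\mathbb{R}^\ell$. Set $$\mathcal{A}=\{u\in H^2(0,L;\mathbb{R}^3):\ \Phi(u(x))=0,\ |u'(x)|^2=1 \text{ for all } x\in[0,L],\ L_{bc}[u]=\ell_{bc}\},$$ $$I_\gamma[u]=\tfrac12\int_0^L |u''|^2-\gamma|u''\cdot n_S(u)|^2\,dx \ \text{ for } u\in\mathcal{A},\qquad I_\gamma[u]=+\infty \ \text{ for } u\in H^2(0,L;\mathbb{R}^3)\setminus\mathcal{A}.$$ For a partition $0=z_0<z_1<\dots<z_J=L$ with maximal mesh size $h$ let $V_h$ be the space of $C^1$ curves $v:[0,L]\to\mathbb{R}^3$ that are cubic polynomials on each $[z_{j-1},z_j]$,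 let $$\mathcal{A}_h=\{v\in V_h:\ |v'(z_j)|^2=1,\ \Phi(v(z_j))=0 \text{ for } j=0,\dots,J,\ L_{bc}[v]=\ell_{bc}\},$$ and let $I_{\gamma,h}[u]$ be given by the same integral for $u\in\mathcal{A}_h$ and $I_{\gamma,h}[u]=+\infty$ for $u\in H^2(0,L;\mathbb{R}^3)\setminus\mathcal{A}_h$. Assume that $v\mapsto\|v''\|_{L^2}$ is a norm on $\ker L_{bc}$, that $\mathcal{A}\neq\emptyset$, and that $\mathcal{A}\cap H^3(0,L;\mathbb{R}^3)$ is dense in $\mathcal{A}$ with respect to strong convergence in $H^2$. For functionals $F_n,G:H^2(0,L;\mathbb{R}^3)\to\mathbb{R}\cup\{+\infty\}$ consider the following properties. * ($\Gamma$) $G[u]\le\liminf_n F_n[u_n]$ whenever $u_n\rightharpoonup u$ weakly in $H^2$; and for every $u\in H^2$ there are $u_n\to u$ strongly in $H^2$ with $F_n[u_n]\to G[u]$. * (C) If $F_n[u_n]\le c$ for all $n$ and some $c\in\mathbb{R}$, then a subsequence of $(u_n)$ converges weakly in $H^2$ to some $u$ with $G[u]\le\liminf_n F_n[u_n]$ (the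 liminf being taken along the whole sequence). * (Q) If $F_n[u_n]\le\inf F_n+\varepsilon_n$ with $\varepsilon_n\to0$, then every weak limit of a subsequence of $(u_n)$ is a minimizer of $G$, with finite minimal value. Then: 1. For every $0<\gamma<1$ and every sequence of partitions with mesh sizes $h_n\to0$, the functionals $F_n=I_{\gamma,h_n}$ and $G=I_\gamma$ satisfy ($\Gamma$), (C) and (Q). 2. For every sequence $\gamma_n\in(0,1)$ with $\gamma_n\to1$, the functionals $F_n=I_{\gamma_n}$ and $G=I_1$ satisfy ($\Gamma$) and (Q); if moreover $\Phi$ is $C^2$ in a neighbourhood of each point of $S$, they also satisfy (C). 3. If $\Phi$ is $C^2$ in a neighbourhood of each point of $S$ and the principal curvatures of $S$ (the eigenvalues of $-Dn_S(p)$ on the tangent plane at $p\in S$) are bounded in absolute value by $c_S$, then every $u\in H^2(0,L;\mathbb{R}^3)$ with $u(x)\in S$ and $|u'(x)|=1$ for all $x\in[0,L]$ satisfies $|u''|^2\le\kappa_g^2+c_S^2$ almost everywhere in $(0,L)$, where $\kappa_g^2=|u''|^2-|u''\cdot n_S(u)|^2$. -/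

import Mathlib

open Set Filter Topology MeasureTheory
open scoped ContDiff

noncomputable section

namespace ElasticCurves

/-- Euclidean three-space. -/
abbrev E3 : Type := EuclideanSpace ℝ (Fin 3)

/-- Lebesgue measure on the interval `(0, L)`. -/
abbrev intervalMeasure (L : ℝ) : Measure ℝ := volume.restrict (Ioo 0 L)

/-- `L²(0, L; ℝ³)`. -/
abbrev L2 (L : ℝ) : Type := Lp E3 2 (intervalMeasure L)

/-! ### Sobolev spaces on an interval -/

/-- `g` is the weak derivative of `f` on `(0, L)`:
`∫ φ' f = - ∫ φ g` for all `φ ∈ C_c^∞(0, L)`. -/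
def IsWeakDeriv (L : ℝ) (f g : ℝ → E3) : Prop :=
  ∀ φ : ℝ → ℝ, ContDiff ℝ ∞ φ → HasCompactSupport φ → tsupport φ ⊆ Ioo 0 L →
    ∫ x in Ioo 0 L, deriv φ x • f x = - ∫ x in Ioo 0 L, φ x • g x

theorem integrable_L2 {L : ℝ} (f : L2 L) : Integrable f (intervalMeasure L) :=
  (Lp.memLp f).integrable (by norm_num)

theorem integrable_test_smul {L : ℝ} {φ : ℝ → ℝ} (hφ : Continuous φ)
    (hc : HasCompactSupport φ) {f : ℝ → E3} (hf : Integrable f (intervalMeasure L)) :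
    Integrable (fun x => φ x • f x) (intervalMeasure L) := by
  obtain ⟨C, hC⟩ := hc.exists_bound_of_continuous hφ
  exact hf.bdd_smul C hφ.aestronglyMeasurable (Eventually.of_forall hC)

/-- The Sobolev space `H²(0, L; ℝ³)` as a subspace of `L² × L² × L²` with the Hilbert sum norm:
the triples `(u, u', u'')` in which each of the last two entries is the weak derivative
of its predecessor. The induced norm is
`‖u‖_{H²} = (‖u‖_{L²}² + ‖u'‖_{L²}² + ‖u''‖_{L²}²)^{1/2}`. -/
def sobolevH2 (L : ℝ) : Submodule ℝ (PiLp 2 (fun _ : Fin 3 => L2 L)) where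
  carrier := {w | IsWeakDeriv L (w 0) (w 1) ∧ IsWeakDeriv L (w 1) (w 2)}
  zero_mem' := by
    have h : IsWeakDeriv L ((0 : L2 L) : ℝ → E3) ((0 : L2 L) : ℝ → E3) := by
      intro φ _ _ _
      have h0 := Lp.coeFn_zero E3 2 (intervalMeasure L)
      rw [integral_congr_ae (g := fun _ => 0) (by filter_upwards [h0] with x hx; rw [hx]; exact smul_zero _),
        integral_congr_ae (f := fun x => φ x • _) (g := fun _ => 0)
          (by filter_upwards [h0] with x hx; rw [hx]; exact smul_zero _)]
      simp
    exact ⟨h, h⟩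
  add_mem' := by
    have h : ∀ f f' g g' : L2 L, IsWeakDeriv L f g → IsWeakDeriv L f' g' →
        IsWeakDeriv L (f + f' : L2 L) (g + g' : L2 L) := by
      intro f f' g g' h h' φ h1 h2 h3
      have c1 := h1.continuous
      have c2 := h1.continuous_deriv (by simp)
      rw [integral_congr_ae (g := fun x => deriv φ x • f x + deriv φ x • f' x)
          (by filter_upwards [Lp.coeFn_add f f'] with x hx; rw [hx]; exact smul_add _ _ _),
        integral_congr_ae (f := fun x => φ x • _) (g := fun x => φ x • g x + φ x • g' x)
          (by filter_upwards [Lp.coeFn_add g g'] with x hx; rw [hx]; exact smul_add _ _ _),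
        integral_add (integrable_test_smul c2 h2.deriv (integrable_L2 f))
          (integrable_test_smul c2 h2.deriv (integrable_L2 f')),
        integral_add (integrable_test_smul c1 h2 (integrable_L2 g))
          (integrable_test_smul c1 h2 (integrable_L2 g')), h φ h1 h2 h3, h' φ h1 h2 h3]
      abel
    intro a b ha hb
    exact ⟨h _ _ _ _ ha.1 hb.1, h _ _ _ _ ha.2 hb.2⟩
  smul_mem' := by
    have h : ∀ (c : ℝ) (f g : L2 L), IsWeakDeriv L f g →
        IsWeakDeriv L (c • f : L2 L) (c • g : L2 L) := by
      intro c f g h φ h1 h2 h3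
      rw [integral_congr_ae (g := fun x => c • deriv φ x • f x)
          (by filter_upwards [Lp.coeFn_smul c f] with x hx; simp [hx, smul_comm c]),
        integral_congr_ae (f := fun x => φ x • _) (g := fun x => c • φ x • g x)
          (by filter_upwards [Lp.coeFn_smul c g] with x hx; simp [hx, smul_comm c]),
        integral_smul, integral_smul, h φ h1 h2 h3, smul_neg]
    intro c a ha
    exact ⟨h _ _ _ ha.1, h _ _ _ ha.2⟩

/-- The Hilbert space `H²(0, L; ℝ³)`. -/
abbrev H2 (L : ℝ) : Type := ↥(sobolevH2 L)

theorem integral_deriv_smul_primitive {L : ℝ} {g : ℝ → E3}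
    (hg : Integrable g (intervalMeasure L)) {φ : ℝ → ℝ} (h1 : ContDiff ℝ ∞ φ)
    (h2 : HasCompactSupport φ) (h3 : tsupport φ ⊆ Ioo 0 L) :
    ∫ x in Ioo 0 L, deriv φ x • (∫ t in (0 : ℝ)..x, g t) = - ∫ x in Ioo 0 L, φ x • g x := by
  have c2 := h1.continuous_deriv (by simp)
  have hint : Integrable (fun p : ℝ × ℝ => deriv φ p.1 • g p.2)
      ((intervalMeasure L).prod (intervalMeasure L)) := by
    have hd : Integrable (deriv φ) (intervalMeasure L) :=
      (c2.integrable_of_hasCompactSupport h2.deriv).restrict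
    exact hd.smul_prod hg
  have hms : MeasurableSet {p : ℝ × ℝ | p.2 < p.1} :=
    measurableSet_lt measurable_snd measurable_fst
  have hint' := hint.indicator hms
  have hsw := integral_integral_swap (μ := intervalMeasure L) (ν := intervalMeasure L)
    (f := fun x t => ({p : ℝ × ℝ | p.2 < p.1}.indicator
      (fun p : ℝ × ℝ => deriv φ p.1 • g p.2)) (x, t)) hint'
  calc ∫ x in Ioo 0 L, deriv φ x • (∫ t in (0 : ℝ)..x, g t)
      = ∫ x in Ioo 0 L, ∫ t in Ioo 0 L, ({p : ℝ × ℝ | p.2 < p.1}.indicator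
          (fun p : ℝ × ℝ => deriv φ p.1 • g p.2)) (x, t) := by
        refine setIntegral_congr_fun measurableSet_Ioo fun x hx => ?_
        have : ∀ t, ({p : ℝ × ℝ | p.2 < p.1}.indicator
          (fun p : ℝ × ℝ => deriv φ p.1 • g p.2)) (x, t)
            = (Iio x).indicator (fun t => deriv φ x • g t) t := fun t => by
          by_cases ht : t < x <;> simp [indicator, ht]
        simp only [this]
        rw [setIntegral_indicator measurableSet_Iio, integral_smul,
          intervalIntegral.integral_of_le hx.1.le, integral_Ioc_eq_integral_Ioo]
        congr 2
        have : Ioo 0 L ∩ Iio x = Ioo 0 x := by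
          ext t; simp only [mem_inter_iff, mem_Ioo, mem_Iio]
          exact ⟨fun h => ⟨h.1.1, h.2⟩, fun h => ⟨⟨h.1, h.2.trans hx.2⟩, h.2⟩⟩
        rw [this]
    _ = ∫ t in Ioo 0 L, ∫ x in Ioo 0 L, ({p : ℝ × ℝ | p.2 < p.1}.indicator
          (fun p : ℝ × ℝ => deriv φ p.1 • g p.2)) (x, t) := hsw
    _ = ∫ t in Ioo 0 L, -(φ t • g t) := by
        refine setIntegral_congr_fun measurableSet_Ioo fun t ht => ?_
        have : ∀ x, ({p : ℝ × ℝ | p.2 < p.1}.indicator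
          (fun p : ℝ × ℝ => deriv φ p.1 • g p.2)) (x, t)
            = (Ioi t).indicator (fun x => deriv φ x • g t) x := fun x => by
          by_cases hx : t < x <;> simp [indicator, hx]
        simp only [this]
        rw [setIntegral_indicator measurableSet_Ioi, integral_smul_const]
        have hs : Ioo 0 L ∩ Ioi t = Ioo t L := by
          ext x; simp only [mem_inter_iff, mem_Ioo, mem_Ioi]
          exact ⟨fun h => ⟨h.2, h.1.2⟩, fun h => ⟨⟨ht.1.trans h.1, h.2⟩, h.1⟩⟩
        have hL : φ L = 0 := by
          by_contra h
          exact lt_irrefl L (h3 (subset_tsupport φ h)).2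
        rw [hs, ← integral_Ioc_eq_integral_Ioo, ← intervalIntegral.integral_of_le ht.2.le,
          intervalIntegral.integral_deriv_eq_sub
            (fun x _ => (h1.differentiable (by simp)).differentiableAt)
            (c2.intervalIntegrable _ _), hL]
        simp
    _ = _ := integral_neg _

theorem exists_test_primitive {L : ℝ} {η : ℝ → ℝ} (h1 : ContDiff ℝ ∞ η)
    (h2 : HasCompactSupport η) (h3 : tsupport η ⊆ Ioo 0 L)
    (h0 : ∫ x in Ioo 0 L, η x = 0) :
    ∃ φ : ℝ → ℝ, ContDiff ℝ ∞ φ ∧ HasCompactSupport φ ∧ tsupport φ ⊆ Ioo 0 L ∧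
      deriv φ = η := by
  rcases (tsupport η).eq_empty_or_nonempty with he | hne
  · refine ⟨0, contDiff_const, HasCompactSupport.zero, by simp, ?_⟩
    have : η = 0 := by rwa [tsupport_eq_empty_iff] at he
    subst this
    ext x; simp
  obtain ⟨a, ha, hamin⟩ := h2.exists_isLeast hne
  obtain ⟨b, hb, hbmax⟩ := h2.exists_isGreatest hne
  have ha0 := h3 ha
  have hb0 := h3 hb
  have hη0 : ∀ x, x ∉ Icc a b → η x = 0 := fun x hx => by
    by_contra h
    exact hx ⟨hamin (subset_tsupport η h), hbmax (subset_tsupport η h)⟩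
  set φ : ℝ → ℝ := fun x => ∫ t in (0 : ℝ)..x, η t with hφ
  have hd : ∀ x, HasDerivAt φ (η x) x := fun x =>
    h1.continuous.integral_hasStrictDerivAt 0 x |>.hasDerivAt
  have hderiv : deriv φ = η := funext fun x => (hd x).deriv
  have hLpos : 0 < L := ha0.1.trans ha0.2
  have hsupp : Function.support φ ⊆ Icc a b := by
    intro x hx
    by_contra hxn
    apply hx
    rw [mem_Icc, not_and_or, not_le, not_le] at hxn
    rcases hxn with h | h
    · have : EqOn η 0 (uIcc 0 x) := fun t ht => by
        apply hη0
        intro htm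
        have : t ≤ max 0 x := ht.2
        exact absurd (htm.1.trans this) (not_le.2 (max_lt ha0.1 h))
      rw [hφ]
      simp only
      rw [intervalIntegral.integral_congr this]; simp
    · have hsum : ∫ t in (0 : ℝ)..L, η t = 0 := by
        rw [intervalIntegral.integral_of_le hLpos.le, integral_Ioc_eq_integral_Ioo, h0]
      have : EqOn η 0 (uIcc L x) := fun t ht => by
        apply hη0
        intro htm
        have : min L x ≤ t := ht.1
        exact absurd (this.trans htm.2) (not_le.2 (lt_min hb0.2 h))
      rw [hφ]
      simp only
      rw [← intervalIntegral.integral_add_adjacent_intervals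
        (h1.continuous.intervalIntegrable 0 L) (h1.continuous.intervalIntegrable L x), hsum,
        intervalIntegral.integral_congr this]; simp
  have hts : tsupport φ ⊆ Icc a b := closure_minimal hsupp isClosed_Icc
  refine ⟨φ, ?_, HasCompactSupport.of_support_subset_isCompact isCompact_Icc hsupp,
    hts.trans fun x hx => ⟨ha0.1.trans_le hx.1, hx.2.trans_lt hb0.2⟩, hderiv⟩
  rw [contDiff_infty_iff_deriv]
  exact ⟨fun x => (hd x).differentiableAt, hderiv ▸ h1⟩

/-- A function with an integrable weak derivative `g` agrees almost everywhere with an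
absolutely continuous primitive of `g`. -/
theorem IsWeakDeriv.exists_primitive {L : ℝ} {f g : ℝ → E3}
    (hf : Integrable f (intervalMeasure L)) (hg : Integrable g (intervalMeasure L))
    (h : IsWeakDeriv L f g) :
    ∃ c : E3, f =ᵐ[intervalMeasure L] fun x => c + ∫ t in (0 : ℝ)..x, g t := by
  rcases le_or_gt L 0 with hL | hL
  · refine ⟨0, ?_⟩
    simp [intervalMeasure, Ioo_eq_empty_of_le hL, EventuallyEq]
  obtain ⟨ψ, hψ1, hψ2, hψ3, hψ4⟩ : ∃ ψ : ℝ → ℝ, ContDiff ℝ ∞ ψ ∧ HasCompactSupport ψ ∧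
      tsupport ψ ⊆ Ioo 0 L ∧ ∫ x in Ioo 0 L, ψ x = 1 := by
    let B : ContDiffBump (L / 2) := ⟨L / 8, L / 4, by linarith, by linarith⟩
    have hs : tsupport (B.normed volume) ⊆ Ioo 0 L := by
      rw [B.tsupport_normed_eq, Real.closedBall_eq_Icc]
      intro x hx
      have h1 := hx.1
      have h2 := hx.2
      simp only [B] at h1 h2
      constructor <;> linarith
    refine ⟨B.normed volume, B.contDiff_normed, B.hasCompactSupport_normed, hs, ?_⟩
    rw [setIntegral_eq_integral_of_forall_compl_eq_zero, B.integral_normed]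
    intro x hx
    by_contra hne
    exact hx (hs (subset_tsupport _ hne))
  set G : ℝ → E3 := fun x => ∫ t in (0 : ℝ)..x, g t with hG
  have hGi : Integrable G (intervalMeasure L) := by
    have hgi : IntegrableOn g (uIcc 0 L) := by
      rw [uIcc_of_le hL.le, integrableOn_Icc_iff_integrableOn_Ioo]; exact hg
    have hc : ContinuousOn G (Icc 0 L) := by
      rw [← uIcc_of_le hL.le]
      exact intervalIntegral.continuousOn_primitive_interval hgi
    exact (hc.integrableOn_Icc).mono_set Ioo_subset_Icc_self
  set w : ℝ → E3 := fun x => f x - G x with hw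
  have hwi : Integrable w (intervalMeasure L) := hf.sub hGi
  have hw0 : ∀ φ : ℝ → ℝ, ContDiff ℝ ∞ φ → HasCompactSupport φ → tsupport φ ⊆ Ioo 0 L →
      ∫ x in Ioo 0 L, deriv φ x • w x = 0 := by
    intro φ h1 h2 h3
    have c2 := h1.continuous_deriv (by simp)
    simp only [hw, smul_sub]
    rw [integral_sub (integrable_test_smul c2 h2.deriv hf)
      (integrable_test_smul c2 h2.deriv hGi), h φ h1 h2 h3,
      integral_deriv_smul_primitive hg h1 h2 h3, sub_self]
  refine ⟨∫ x in Ioo 0 L, ψ x • w x, ?_⟩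
  set c : E3 := ∫ x in Ioo 0 L, ψ x • w x with hc
  have hwc : Integrable (fun x => w x - c) (intervalMeasure L) :=
    hwi.sub (integrable_const c)
  have key := isOpen_Ioo.ae_eq_zero_of_integral_contDiff_smul_eq_zero
    (μ := intervalMeasure L) (U := Ioo 0 L) (f := fun x => w x - c)
    (hwc.integrableOn.locallyIntegrableOn) (by
      intro η h1 h2 h3
      set m : ℝ := ∫ x in Ioo 0 L, η x with hm
      have hηi : Integrable η (intervalMeasure L) :=
        (h1.continuous.integrable_of_hasCompactSupport h2).restrict
      have hψi : Integrable ψ (intervalMeasure L) :=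
        (hψ1.continuous.integrable_of_hasCompactSupport hψ2).restrict
      obtain ⟨φ, p1, p2, p3, p4⟩ := exists_test_primitive (L := L)
        (η := η - m • ψ) (h1.sub (hψ1.const_smul m))
        (h2.sub (hψ2.mono (Function.support_const_smul_subset m ψ)))
        ((tsupport_sub η (m • ψ)).trans (union_subset h3
          ((closure_mono (Function.support_const_smul_subset m ψ)).trans hψ3)))
        (by
          have hs : Integrable (fun x => m • ψ x) (intervalMeasure L) := hψi.smul m
          simp only [Pi.sub_apply, Pi.smul_apply]
          rw [integral_sub hηi hs, integral_smul, hψ4, ← hm]; simp)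
      have e := hw0 φ p1 p2 p3
      rw [p4] at e
      have i1 := integrable_test_smul h1.continuous h2 hwi
      have i2 := integrable_test_smul hψ1.continuous hψ2 hwi
      have i3 := integrable_test_smul h1.continuous h2 (integrable_const (μ := intervalMeasure L) c)
      have e' : ∫ x in Ioo 0 L, (η x • w x - m • ψ x • w x) = 0 := by
        rw [← e]
        refine integral_congr_ae (Eventually.of_forall fun x => ?_)
        simp [sub_smul, mul_smul]
      have i4 : Integrable (fun x => m • ψ x • w x) (intervalMeasure L) := i2.smul m
      rw [integral_sub i1 i4, integral_smul, ← hc] at e'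
      simp only [smul_sub]
      rw [integral_sub i1 i3, integral_smul_const, ← hm, e'])
  have key' : ∀ᵐ x ∂(intervalMeasure L), x ∈ Ioo 0 L := ae_restrict_mem measurableSet_Ioo
  filter_upwards [key, key'] with x hx hx'
  have := hx hx'
  simp only [hw] at this
  have h3 : f x = c + G x := by
    rw [sub_sub, sub_eq_zero] at this
    rw [this, add_comm]
  exact h3

theorem exists_continuous_rep {L : ℝ} {f g : L2 L} (h : IsWeakDeriv L f g) :
    ∃ F : ℝ → E3, ContinuousOn F (Icc 0 L) ∧ F =ᵐ[intervalMeasure L] f := by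
  obtain ⟨c, hc⟩ := h.exists_primitive (integrable_L2 f) (integrable_L2 g)
  refine ⟨_, ?_, hc.symm⟩
  rcases le_or_gt 0 L with hL | hL
  · have hgi : IntegrableOn g (uIcc 0 L) := by
      rw [uIcc_of_le hL, integrableOn_Icc_iff_integrableOn_Ioo]; exact integrable_L2 g
    have := intervalIntegral.continuousOn_primitive_interval hgi
    rw [uIcc_of_le hL] at this
    exact continuousOn_const.add this
  · simp [Icc_eq_empty_of_lt hL]

namespace H2

variable {L : ℝ}

/-- The continuous representative of `u ∈ H²(0, L; ℝ³)` on `[0, L]`. -/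
def val (u : H2 L) : ℝ → E3 := Classical.choose (exists_continuous_rep u.2.1)

/-- The continuous representative of `u'` on `[0, L]`. -/
def der (u : H2 L) : ℝ → E3 := Classical.choose (exists_continuous_rep u.2.2)

/-- The second weak derivative `u'' ∈ L²(0, L; ℝ³)`. -/
def der2 (u : H2 L) : L2 L := (u : PiLp 2 (fun _ : Fin 3 => L2 L)) 2

theorem continuousOn_val (u : H2 L) : ContinuousOn u.val (Icc 0 L) :=
  (Classical.choose_spec (exists_continuous_rep u.2.1)).1

theorem val_ae_eq (u : H2 L) :
    u.val =ᵐ[intervalMeasure L] (u : PiLp 2 (fun _ : Fin 3 => L2 L)) 0 :=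
  (Classical.choose_spec (exists_continuous_rep u.2.1)).2

theorem continuousOn_der (u : H2 L) : ContinuousOn u.der (Icc 0 L) :=
  (Classical.choose_spec (exists_continuous_rep u.2.2)).1

theorem der_ae_eq (u : H2 L) :
    u.der =ᵐ[intervalMeasure L] (u : PiLp 2 (fun _ : Fin 3 => L2 L)) 1 :=
  (Classical.choose_spec (exists_continuous_rep u.2.2)).2

end H2

/-- `H³(0, L; ℝ³)`, as a subset of `H²(0, L; ℝ³)`. -/
def sobolevH3 (L : ℝ) : Set (H2 L) := {u | ∃ g : L2 L, IsWeakDeriv L u.der2 g}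

/-! ### Surface, normal field and curvatures -/

/-- The field `n_S = Φ' / |Φ'|` (with value `0` where `Φ'` vanishes). -/
def unitNormal (Φ : E3 → ℝ) (p : E3) : E3 := ‖gradient Φ p‖⁻¹ • gradient Φ p

/-- `κ` is a principal curvature at `p` of the level set of `Φ` through `p`: an eigenvalue of the
Weingarten map `-D n_S(p)` on the tangent plane `{τ | Φ'(p) ⬝ τ = 0}`. -/
def IsPrincipalCurvature (Φ : E3 → ℝ) (p : E3) (κ : ℝ) : Prop :=
  ∃ τ : E3, τ ≠ 0 ∧ inner ℝ (gradient Φ p) τ = 0 ∧ -(fderiv ℝ (unitNormal Φ) p τ) = κ • τ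

/-- `u` takes values in the zero level set of `Φ` and is parametrized by arclength. -/
def IsArclengthCurveOn {L : ℝ} (Φ : E3 → ℝ) (u : H2 L) : Prop :=
  ∀ x ∈ Icc 0 L, Φ (u.val x) = 0 ∧ ‖u.der x‖ ^ 2 = 1

/-- The squared geodesic curvature `κ_g² = |u''|² - |u'' ⬝ n_S(u)|²`. -/
def geodesicCurvatureSq {L : ℝ} (Φ : E3 → ℝ) (u : H2 L) (x : ℝ) : ℝ :=
  ‖u.der2 x‖ ^ 2 - |inner ℝ (u.der2 x) (unitNormal Φ (u.val x))| ^ 2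

/-- `½ ∫₀ᴸ |u''|² - γ |u'' ⬝ n_S(u)|² dx`. -/
def stabilizedIntegral {L : ℝ} (Φ : E3 → ℝ) (γ : ℝ) (u : H2 L) : ℝ :=
  1 / 2 * ∫ x in Ioo 0 L,
    (‖u.der2 x‖ ^ 2 - γ * |inner ℝ (u.der2 x) (unitNormal Φ (u.val x))| ^ 2)

/-! ### The continuous problem -/

/-- The boundary operator depends only on the values of `v` and `v'` at `0` and `L`. -/
def DependsOnBoundaryValues {L : ℝ} {ℓ : ℕ} (Lbc : H2 L →L[ℝ] EuclideanSpace ℝ (Fin ℓ)) : Prop :=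
  ∀ v w : H2 L, v.val 0 = w.val 0 → v.val L = w.val L → v.der 0 = w.der 0 → v.der L = w.der L →
    Lbc v = Lbc w

/-- The admissible set `𝒜`. -/
def admissible {L : ℝ} {ℓ : ℕ} (Φ : E3 → ℝ) (Lbc : H2 L →L[ℝ] EuclideanSpace ℝ (Fin ℓ))
    (b : EuclideanSpace ℝ (Fin ℓ)) : Set (H2 L) :=
  {u | IsArclengthCurveOn Φ u ∧ Lbc u = b}

open Classical in
/-- The functional `I_γ`, extended by `+∞` outside of `𝒜`. -/
def energy {L : ℝ} {ℓ : ℕ} (Φ : E3 → ℝ) (Lbc : H2 L →L[ℝ] EuclideanSpace ℝ (Fin ℓ))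
    (b : EuclideanSpace ℝ (Fin ℓ)) (γ : ℝ) (u : H2 L) : EReal :=
  if u ∈ admissible Φ Lbc b then (stabilizedIntegral Φ γ u : EReal) else ⊤

/-! ### The discrete problem -/

/-- A partition `0 = z_0 < z_1 < ⋯ < z_J = L`. -/
structure Partition (L : ℝ) where
  J : ℕ
  z : Fin (J + 1) → ℝ
  strictMono : StrictMono z
  first : z 0 = 0
  last : z (Fin.last J) = L

/-- The maximal length of a subinterval. -/
def Partition.meshSize {L : ℝ} (T : Partition L) : ℝ :=
  ⨆ j : Fin T.J, (T.z j.succ - T.z j.castSucc)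

/-- The finite element space `V_h` of continuously differentiable, piecewise cubic curves
(membership in `H²(0, L; ℝ³)` gives the continuity of `v` and `v'`). -/
def feSpace {L : ℝ} (T : Partition L) : Set (H2 L) :=
  {v | ∀ j : Fin T.J, ∃ a : Fin 4 → E3, ∀ x ∈ Icc (T.z j.castSucc) (T.z j.succ),
    v.val x = ∑ i : Fin 4, x ^ (i : ℕ) • a i}

/-- The discrete admissible set `𝒜_h`, with the constraints imposed at the nodes. -/
def discreteAdmissible {L : ℝ} {ℓ : ℕ} (Φ : E3 → ℝ)
    (Lbc : H2 L →L[ℝ] EuclideanSpace ℝ (Fin ℓ)) (b : EuclideanSpace ℝ (Fin ℓ))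
    (T : Partition L) : Set (H2 L) :=
  {v | v ∈ feSpace T ∧
    (∀ j : Fin (T.J + 1), ‖v.der (T.z j)‖ ^ 2 = 1 ∧ Φ (v.val (T.z j)) = 0) ∧ Lbc v = b}

open Classical in
/-- The functional `I_{γ,h}`, extended by `+∞` outside of `𝒜_h`. -/
def discreteEnergy {L : ℝ} {ℓ : ℕ} (Φ : E3 → ℝ)
    (Lbc : H2 L →L[ℝ] EuclideanSpace ℝ (Fin ℓ)) (b : EuclideanSpace ℝ (Fin ℓ)) (γ : ℝ)
    (T : Partition L) (u : H2 L) : EReal :=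
  if u ∈ discreteAdmissible Φ Lbc b T then (stabilizedIntegral Φ γ u : EReal) else ⊤

/-! ### Variational convergence -/

section Gamma

variable {X : Type*} [NormedAddCommGroup X] [NormedSpace ℝ X]

/-- Weak convergence of a sequence in a normed space. -/
def WeaklyConverges (u : ℕ → X) (x : X) : Prop :=
  ∀ f : X →L[ℝ] ℝ, Tendsto (fun n => f (u n)) atTop (𝓝 (f x))

/-- Sequential `Γ`-convergence `F n → G` with respect to weak convergence: the liminf inequality
along weakly convergent sequences and the existence of (strongly convergent)
recovery sequences. -/
structure GammaConverges (F : ℕ → X → EReal) (G : X → EReal) : Prop where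
  liminf_le : ∀ (u : ℕ → X) (x : X), WeaklyConverges u x →
    G x ≤ liminf (fun n => F n (u n)) atTop
  recovery : ∀ x : X, ∃ u : ℕ → X, Tendsto u atTop (𝓝 x) ∧
    Tendsto (fun n => F n (u n)) atTop (𝓝 (G x))

/-- Compactness: a sequence of bounded energy has a weakly convergent subsequence, whose
limit `x` can be chosen such that `G x ≤ liminf F n (u n)` along the whole sequence. -/
def BoundedEnergyCompact (F : ℕ → X → EReal) (G : X → EReal) : Prop :=
  ∀ (u : ℕ → X) (c : ℝ), (∀ n, F n (u n) ≤ (c : EReal)) →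
    ∃ (φ : ℕ → ℕ) (x : X), StrictMono φ ∧ WeaklyConverges (u ∘ φ) x ∧
      G x ≤ liminf (fun n => F n (u n)) atTop

/-- `u n` minimizes `F n` up to an error that tends to zero. -/
def IsQuasiMinimizing (F : ℕ → X → EReal) (u : ℕ → X) : Prop :=
  ∃ ε : ℕ → ℝ, Tendsto ε atTop (𝓝 0) ∧ ∀ n v, F n (u n) ≤ F n v + (ε n : EReal)

/-- `x` is a minimizer of `G`, of finite energy. -/
def IsMinimizer (G : X → EReal) (x : X) : Prop := G x < ⊤ ∧ ∀ y, G x ≤ G y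

/-- Weak limits of subsequences of quasiminimizers of `F n` are minimizers of `G`. -/
def QuasiMinimizersConverge (F : ℕ → X → EReal) (G : X → EReal) : Prop :=
  ∀ u : ℕ → X, IsQuasiMinimizing F u → ∀ (φ : ℕ → ℕ) (x : X), StrictMono φ →
    WeaklyConverges (u ∘ φ) x → IsMinimizer G x

end Gamma

end ElasticCurves

end

noncomputable section

namespace ElasticCurves

variable {L : ℝ}

/-! ### Calculus in `L²(0, L)` -/

/-! The bending energy is a quadratic form ½(‖f‖² - γ‖Q f‖²) in f = u'', where Q f = f · n_S(u) is
an operator on L² of norm at most 1. For 0 ≤ γ ≤ 1 the form is therefore nonnegative, hence convex.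
Weak convergence in H² implies uniform convergence of the curves and of their derivatives: both are
Hölder-1/2 with a common constant, and point evaluations are bounded functionals. If the limit curve
lies on S, then n_S is continuous at every point of its compact image, and the operators Q converge
in norm (`tendsto_normalComponent`). A nonnegative form whose coefficients converge in norm is
weakly lower semicontinuous and strongly continuous (`exists_tendsto_le_stabilizedForm`,
`tendsto_stabilizedForm`).

Both limits, h → 0 and γ → 1, are instances of `constrainedEnergy` with varying constraint sets A n
and parameters γ n. Γ-convergence and convergence of quasiminimizers need two properties of the
sets: weak limits of admissible curves lie in A₀ (`WeaklyClosedInLimit`), and each element of A₀ is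
a strong limit of elements of A n. For γ → 1 the sets are constant and only weak closedness is at
stake. For h → 0 closedness holds because every point is a limit of nodes, and approximation is by
Hermite interpolation, which preserves nodal and boundary data.

Hermite interpolation converges in H² for every u ∈ H² (`exists_hermite_interpolants`). The
interpolant is the curve with the initial data of u whose second derivative is the L² projection of
u'' onto discontinuous piecewise affine functions. Orthogonality kills the two moments of the error
on each cell, which is what carries agreement of value and slope from one node to the next
(`H2.nodes_eq_zero`). The projections converge because continuous functions are dense in L².

Compactness needs H² bounds. The kernel condition gives ‖v‖ ≤ C(‖v''‖ + ‖L_bc v‖)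
(`exists_norm_le_der2_add`). For fixed γ < 1 the energy dominates (1 - γ)/2 ‖u''‖². As γ → 1 this
degenerates and the normal part of u'' must be bounded otherwise: differentiating n_S(u) · u' = 0
gives u'' · n_S(u) = -Dn_S(u)u' · u', which is bounded on bounded parts of S, and unit speed
together with the boundary data confines the curves to a fixed ball
(`exists_norm_val_le_of_unit_speed`). The same identity, with the spectral bound for the symmetric
Weingarten map, gives the pointwise curvature estimate. -/

theorem Icc_subset_of_mem {a b : ℝ} (ha : a ∈ Icc 0 L) (hb : b ∈ Icc 0 L) :
    uIcc a b ⊆ Icc 0 L := by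
  rw [← uIcc_of_le (ha.1.trans ha.2)] at *
  exact uIcc_subset_uIcc ha hb

theorem intervalIntegrable_L2 (f : L2 L) {a b : ℝ} (ha : a ∈ Icc 0 L) (hb : b ∈ Icc 0 L) :
    IntervalIntegrable f volume a b := by
  rw [intervalIntegrable_iff']
  refine IntegrableOn.mono_set ?_ (Icc_subset_of_mem ha hb)
  rw [integrableOn_Icc_iff_integrableOn_Ioo]
  exact integrable_L2 f

/-- Cauchy–Schwarz on (a, b). It is the source of all Hölder-1/2 estimates and of the embedding of
H² into C¹. -/
theorem norm_intervalIntegral_le (f : L2 L) {a b : ℝ} (ha : a ∈ Icc 0 L) (hb : b ∈ Icc 0 L) :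
    ‖∫ t in a..b, f t‖ ≤ √|b - a| * ‖f‖ := by
  wlog hab : a ≤ b generalizing a b
  · rw [intervalIntegral.integral_symm, norm_neg, abs_sub_comm]
    exact this hb ha (le_of_not_ge hab)
  have hsub : Ioo a b ⊆ Ioo 0 L := Ioo_subset_Ioo ha.1 hb.2
  have hμ : (intervalMeasure L) (Ioo a b) = ENNReal.ofReal (b - a) := by
    rw [Measure.restrict_apply measurableSet_Ioo, inter_eq_left.2 hsub, Real.volume_Ioo]
  have hr : (intervalMeasure L).restrict (Ioo a b) = volume.restrict (Ioo a b) := by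
    rw [Measure.restrict_restrict measurableSet_Ioo, inter_eq_left.2 hsub]
  have hne : (intervalMeasure L) (Ioo a b) ≠ ⊤ := by rw [hμ]; exact ENNReal.ofReal_ne_top
  rw [intervalIntegral.integral_of_le hab, integral_Ioc_eq_integral_Ioo]
  set c : E3 := ∫ t in Ioo a b, f t with hc
  -- Testing f with the constant c = ∫ f itself gives ‖c‖² ≤ √(b - a) ‖c‖ ‖f‖, and one factor ‖c‖
  -- cancels.
  have h1 := L2.inner_indicatorConstLp_eq_inner_setIntegral ℝ (μ := intervalMeasure L)
    measurableSet_Ioo hne c f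
  rw [hr, ← hc, real_inner_self_eq_norm_sq] at h1
  have h2 := real_inner_le_norm (indicatorConstLp 2 (measurableSet_Ioo (a := a) (b := b)) hne c) f
  rw [h1, norm_indicatorConstLp (by norm_num) (by norm_num), Measure.real, hμ,
    ENNReal.toReal_ofReal (sub_nonneg.2 hab)] at h2
  rw [abs_of_nonneg (sub_nonneg.2 hab), Real.sqrt_eq_rpow]
  norm_num at h2 ⊢
  rcases eq_or_ne ‖c‖ 0 with h0 | h0
  · rw [h0]; positivity
  · have hpos : 0 < ‖c‖ := lt_of_le_of_ne (norm_nonneg c) (Ne.symm h0)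
    refine le_of_mul_le_mul_left ?_ hpos
    nlinarith

theorem sqrt_abs_sub_le {a b : ℝ} (ha : a ∈ Icc 0 L) (hb : b ∈ Icc 0 L) : √|b - a| ≤ √L := by
  apply Real.sqrt_le_sqrt
  rw [abs_le]
  constructor <;> linarith [ha.1, ha.2, hb.1, hb.2]

theorem continuousOn_primitive (c : E3) (g : L2 L) :
    ContinuousOn (fun x => c + ∫ t in (0 : ℝ)..x, g t) (Icc 0 L) := by
  rcases le_or_gt 0 L with hL | hL
  · have hgi : IntegrableOn g (uIcc 0 L) := by
      rw [uIcc_of_le hL, integrableOn_Icc_iff_integrableOn_Ioo]; exact integrable_L2 g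
    have := intervalIntegral.continuousOn_primitive_interval hgi
    rw [uIcc_of_le hL] at this
    exact continuousOn_const.add this
  · simp [Icc_eq_empty_of_lt hL]

theorem norm_primitive_le (c : E3) (g : L2 L) {x : ℝ} (hx : x ∈ Icc 0 L) :
    ‖c + ∫ t in (0 : ℝ)..x, g t‖ ≤ ‖c‖ + √L * ‖g‖ := by
  have h0 : (0 : ℝ) ∈ Icc 0 L := ⟨le_rfl, hx.1.trans hx.2⟩
  refine (norm_add_le _ _).trans (add_le_add le_rfl ?_)
  exact (norm_intervalIntegral_le g h0 hx).trans
    (mul_le_mul_of_nonneg_right (sqrt_abs_sub_le h0 hx) (norm_nonneg _))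

theorem ae_mem_Icc : ∀ᵐ x ∂(intervalMeasure L), x ∈ Icc 0 L :=
  (ae_restrict_mem measurableSet_Ioo).mono fun _ hx => Ioo_subset_Icc_self hx

theorem memLp_of_continuousOn {E : Type*} [NormedAddCommGroup E] {F : ℝ → E}
    (hF : ContinuousOn F (Icc 0 L)) : MemLp F 2 (intervalMeasure L) := by
  obtain ⟨C, hC⟩ := isCompact_Icc.exists_bound_of_continuousOn hF
  refine MemLp.of_bound ?_ C ?_
  · exact (hF.mono Ioo_subset_Icc_self).aestronglyMeasurable measurableSet_Ioo
  · exact ae_mem_Icc.mono fun x hx => hC x hx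

/-- The primitive `c + ∫₀ˣ g` as an element of `L²`. -/
def primitiveLp (c : E3) (g : L2 L) : L2 L :=
  (memLp_of_continuousOn (continuousOn_primitive c g)).toLp _

theorem coeFn_primitiveLp (c : E3) (g : L2 L) :
    primitiveLp c g =ᵐ[intervalMeasure L] fun x => c + ∫ t in (0 : ℝ)..x, g t :=
  MemLp.coeFn_toLp _

theorem intervalIntegral_congr_Lp {f g : ℝ → E3} (h : f =ᵐ[intervalMeasure L] g) {a b : ℝ}
    (ha : a ∈ Icc 0 L) (hb : b ∈ Icc 0 L) : ∫ t in a..b, f t = ∫ t in a..b, g t := by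
  apply intervalIntegral.integral_congr_ae_restrict
  have : uIoc a b ⊆ Ioc 0 L := Ioc_subset_Ioc (le_min ha.1 hb.1) (max_le ha.2 hb.2)
  refine ae_restrict_of_ae_restrict_of_subset this ?_
  rwa [← Measure.restrict_congr_set (Ioo_ae_eq_Ioc (μ := volume) (a := 0) (b := L))]

/-- The primitive depends linearly and boundedly on the initial value and the integrand. -/
def primitiveCLM (L : ℝ) : E3 × L2 L →L[ℝ] L2 L :=
  LinearMap.mkContinuousOfExistsBound
    { toFun := fun p => primitiveLp p.1 p.2
      map_add' := by
        intro p q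
        apply Lp.ext
        filter_upwards [coeFn_primitiveLp (p + q).1 (p + q).2, coeFn_primitiveLp p.1 p.2,
          coeFn_primitiveLp q.1 q.2, Lp.coeFn_add (primitiveLp p.1 p.2) (primitiveLp q.1 q.2),
          ae_mem_Icc] with x h1 h2 h3 h4 hx
        have h0 : (0 : ℝ) ∈ Icc 0 L := ⟨le_rfl, hx.1.trans hx.2⟩
        rw [h1, h4, Pi.add_apply, h2, h3, Prod.fst_add, Prod.snd_add,
          intervalIntegral_congr_Lp (Lp.coeFn_add p.2 q.2) h0 hx]
        simp only [Pi.add_apply]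
        rw [intervalIntegral.integral_add (intervalIntegrable_L2 _ h0 hx)
          (intervalIntegrable_L2 _ h0 hx)]
        abel
      map_smul' := by
        intro r p
        apply Lp.ext
        filter_upwards [coeFn_primitiveLp (r • p).1 (r • p).2, coeFn_primitiveLp p.1 p.2,
          Lp.coeFn_smul r (primitiveLp p.1 p.2), ae_mem_Icc] with x h1 h2 h4 hx
        have h0 : (0 : ℝ) ∈ Icc 0 L := ⟨le_rfl, hx.1.trans hx.2⟩
        rw [h1, RingHom.id_apply, h4, Pi.smul_apply, h2, Prod.smul_fst, Prod.smul_snd,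
          intervalIntegral_congr_Lp (Lp.coeFn_smul r p.2) h0 hx]
        simp only [Pi.smul_apply]
        rw [intervalIntegral.integral_smul, smul_add] }
    (by
      refine ⟨(intervalMeasure L).real univ ^ (1 / 2 : ℝ) * (1 + √L), fun p => ?_⟩
      have h := Lp.norm_le_of_ae_bound (f := primitiveLp p.1 p.2)
        (C := ‖p.1‖ + √L * ‖p.2‖) (by positivity) (by
          filter_upwards [coeFn_primitiveLp p.1 p.2, ae_mem_Icc] with x h1 hx
          rw [h1]
          exact norm_primitive_le _ _ hx)
      refine h.trans ?_
      have e : ((2 : ENNReal).toReal)⁻¹ = (1 / 2 : ℝ) := by norm_num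
      rw [e, mul_assoc]
      have h1 : ‖p.1‖ + √L * ‖p.2‖ ≤ (1 + √L) * ‖p‖ := by
        have a1 := norm_fst_le p
        have a2 := mul_le_mul_of_nonneg_left (norm_snd_le p) (Real.sqrt_nonneg L)
        linarith
      exact mul_le_mul_of_nonneg_left h1 (by positivity))

theorem IsWeakDeriv.congr {f f' g g' : ℝ → E3} (h : IsWeakDeriv L f g)
    (hf : f' =ᵐ[intervalMeasure L] f) (hg : g' =ᵐ[intervalMeasure L] g) :
    IsWeakDeriv L f' g' := by
  intro φ h1 h2 h3
  rw [integral_congr_ae (g := fun x => deriv φ x • f x) (hf.mono fun x hx => by simp only [hx]),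
    integral_congr_ae (f := fun x => φ x • g' x) (g := fun x => φ x • g x)
      (hg.mono fun x hx => by simp only [hx])]
  exact h φ h1 h2 h3

/-- The constant drops out because φ' has integral zero. -/
theorem isWeakDeriv_primitive (hL : 0 < L) (c : E3) (g : L2 L) :
    IsWeakDeriv L (fun x => c + ∫ t in (0 : ℝ)..x, g t) g := by
  intro φ h1 h2 h3
  have c2 := h1.continuous_deriv (by simp)
  have hz : ∀ x, x ∉ Ioo 0 L → φ x = 0 := fun x hx => by
    by_contra h
    exact hx (h3 (subset_tsupport φ h))
  have h0 : ∫ x in Ioo 0 L, deriv φ x = 0 := by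
    rw [← integral_Ioc_eq_integral_Ioo, ← intervalIntegral.integral_of_le hL.le,
      intervalIntegral.integral_deriv_eq_sub
        (fun x _ => (h1.differentiable (by simp)).differentiableAt)
        (c2.intervalIntegrable _ _), hz 0 (by simp), hz L (by simp), sub_self]
  have hGi : Integrable (fun x => ∫ t in (0 : ℝ)..x, g t) (intervalMeasure L) := by
    have := (continuousOn_primitive 0 g).integrableOn_Icc.mono_set
      (Ioo_subset_Icc_self (a := 0) (b := L)) (μ := volume)
    simpa [IntegrableOn] using this
  simp only [smul_add]
  rw [integral_add (integrable_test_smul c2 h2.deriv (integrable_const _))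
    (integrable_test_smul c2 h2.deriv hGi), integral_smul_const, h0, zero_smul, zero_add,
    integral_deriv_smul_primitive (integrable_L2 g) h1 h2 h3]

theorem isWeakDeriv_primitiveLp (hL : 0 < L) (c : E3) (g : L2 L) :
    IsWeakDeriv L (primitiveLp c g) g :=
  (isWeakDeriv_primitive hL c g).congr (coeFn_primitiveLp c g) (ae_eq_refl _)

theorem eqOn_Icc_of_ae_eq {E : Type*} [TopologicalSpace E] [T2Space E] (hL : 0 < L) {F G : ℝ → E}
    (hF : ContinuousOn F (Icc 0 L)) (hG : ContinuousOn G (Icc 0 L))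
    (h : F =ᵐ[intervalMeasure L] G) : EqOn F G (Icc 0 L) := by
  refine Measure.eqOn_Icc_of_ae_eq volume hL.ne ?_ hF hG
  rwa [← Measure.restrict_congr_set (Ioo_ae_eq_Icc (μ := volume) (a := 0) (b := L))]

theorem eqOn_primitive_of_isWeakDeriv (hL : 0 < L) {f g : L2 L} (h : IsWeakDeriv L f g)
    {F : ℝ → E3} (hF : ContinuousOn F (Icc 0 L)) (hFf : F =ᵐ[intervalMeasure L] f) :
    ∀ x ∈ Icc 0 L, F x = F 0 + ∫ t in (0 : ℝ)..x, g t := by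
  obtain ⟨c, hc⟩ := h.exists_primitive (integrable_L2 f) (integrable_L2 g)
  have he := eqOn_Icc_of_ae_eq hL hF (continuousOn_primitive c g) (hFf.trans hc)
  have h0 := he ⟨le_rfl, hL.le⟩
  simp only [intervalIntegral.integral_same, add_zero] at h0
  intro x hx
  rw [h0]
  exact he hx

/-- For K > 0, comparison with the constant function K, whose norm is √L K. -/
theorem norm_le_of_le_ae_norm (f : L2 L) {K : ℝ}
    (h : ∀ᵐ x ∂(intervalMeasure L), K ≤ ‖f x‖) : √L * K ≤ ‖f‖ := by
  rcases le_or_gt K 0 with hK | hK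
  · exact (mul_nonpos_of_nonneg_of_nonpos (Real.sqrt_nonneg _) hK).trans (norm_nonneg _)
  rcases le_or_gt L 0 with hL | hL
  · rw [Real.sqrt_eq_zero_of_nonpos hL]; simp
  have h1 := Lp.norm_le_norm_of_ae_le (f := Lp.const 2 (intervalMeasure L) K) (g := f) (by
    filter_upwards [h, Lp.coeFn_const (p := 2) (μ := intervalMeasure L) K] with x h1 h2
    rw [h2]
    simpa [abs_of_pos hK] using h1)
  rw [Lp.norm_const' (p := 2) (μ := intervalMeasure L) (c := K) (by norm_num) (by norm_num)] at h1
  simp [Measure.real, hL.le, abs_of_pos hK] at h1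
  rw [Real.sqrt_eq_rpow, mul_comm, one_div]
  exact h1

/-- The oscillation of F is at most √L ‖g‖, so ‖F y‖ ≥ ‖F x‖ - √L ‖g‖ for all y, and this lower
bound limits ‖F x‖ in terms of ‖f‖. Applied to u and u' it yields the embedding into C¹. -/
theorem norm_le_of_primitive (hL : 0 < L) {f g : L2 L} {F : ℝ → E3}
    (hFf : F =ᵐ[intervalMeasure L] f)
    (hF : ∀ x ∈ Icc 0 L, F x = F 0 + ∫ t in (0 : ℝ)..x, g t) {x : ℝ} (hx : x ∈ Icc 0 L) :
    ‖F x‖ ≤ (√L)⁻¹ * ‖f‖ + √L * ‖g‖ := by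
  have h0 : (0 : ℝ) ∈ Icc 0 L := ⟨le_rfl, hL.le⟩
  have hs : 0 < √L := Real.sqrt_pos.2 hL
  have h1 := norm_le_of_le_ae_norm f (K := ‖F x‖ - √L * ‖g‖) (by
    filter_upwards [hFf, ae_mem_Icc] with y h1 hy
    rw [← h1]
    have e : F x = F y + ∫ t in y..x, g t := by
      rw [hF x hx, hF y hy, add_assoc, intervalIntegral.integral_add_adjacent_intervals
        (intervalIntegrable_L2 g h0 hy) (intervalIntegrable_L2 g hy hx)]
    have e1 := norm_intervalIntegral_le g hy hx
    have e2 := mul_le_mul_of_nonneg_right (sqrt_abs_sub_le hy hx) (norm_nonneg g)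
    have e3 := norm_add_le (F y) (∫ t in y..x, g t)
    rw [← e] at e3
    linarith)
  rw [← sub_le_iff_le_add, inv_mul_eq_div, le_div_iff₀ hs, mul_comm]
  exact h1

/-! ### Calculus in `H²(0, L)` -/

namespace H2

theorem zero_mem (hL : 0 < L) : (0 : ℝ) ∈ Icc 0 L := ⟨le_rfl, hL.le⟩

theorem der_eq (hL : 0 < L) (u : H2 L) {x : ℝ} (hx : x ∈ Icc 0 L) :
    u.der x = u.der 0 + ∫ t in (0 : ℝ)..x, u.der2 t :=
  eqOn_primitive_of_isWeakDeriv hL u.2.2 u.continuousOn_der u.der_ae_eq x hx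

theorem val_eq_Lp (hL : 0 < L) (u : H2 L) {x : ℝ} (hx : x ∈ Icc 0 L) :
    u.val x = u.val 0 + ∫ t in (0 : ℝ)..x, (u : PiLp 2 (fun _ : Fin 3 => L2 L)) 1 t :=
  eqOn_primitive_of_isWeakDeriv hL u.2.1 u.continuousOn_val u.val_ae_eq x hx

theorem val_eq (hL : 0 < L) (u : H2 L) {x : ℝ} (hx : x ∈ Icc 0 L) :
    u.val x = u.val 0 + ∫ t in (0 : ℝ)..x, u.der t := by
  rw [val_eq_Lp hL u hx, intervalIntegral_congr_Lp u.der_ae_eq (zero_mem hL) hx]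

theorem intervalIntegrable_der (u : H2 L) {a b : ℝ} (ha : a ∈ Icc 0 L) (hb : b ∈ Icc 0 L) :
    IntervalIntegrable u.der volume a b :=
  (u.continuousOn_der.mono (Icc_subset_of_mem ha hb)).intervalIntegrable

theorem der_sub (hL : 0 < L) (u : H2 L) {x y : ℝ} (hx : x ∈ Icc 0 L) (hy : y ∈ Icc 0 L) :
    u.der y - u.der x = ∫ t in x..y, u.der2 t := by
  rw [der_eq hL u hx, der_eq hL u hy, add_sub_add_left_eq_sub,
    intervalIntegral.integral_interval_sub_left (intervalIntegrable_L2 _ (zero_mem hL) hy)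
    (intervalIntegrable_L2 _ (zero_mem hL) hx)]

theorem val_sub (hL : 0 < L) (u : H2 L) {x y : ℝ} (hx : x ∈ Icc 0 L) (hy : y ∈ Icc 0 L) :
    u.val y - u.val x = ∫ t in x..y, u.der t := by
  rw [val_eq hL u hx, val_eq hL u hy, add_sub_add_left_eq_sub,
    intervalIntegral.integral_interval_sub_left (intervalIntegrable_der _ (zero_mem hL) hy)
    (intervalIntegrable_der _ (zero_mem hL) hx)]

theorem norm_component_le (u : H2 L) (i : Fin 3) :
    ‖(u : PiLp 2 (fun _ : Fin 3 => L2 L)) i‖ ≤ ‖u‖ :=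
  PiLp.norm_apply_le (p := 2) (u : PiLp 2 (fun _ : Fin 3 => L2 L)) i

/-- The constant of the embedding of `H²` into `C¹`. -/
def embeddingConst (L : ℝ) : ℝ := (√L)⁻¹ + √L

theorem norm_val_le (hL : 0 < L) (u : H2 L) {x : ℝ} (hx : x ∈ Icc 0 L) :
    ‖u.val x‖ ≤ embeddingConst L * ‖u‖ := by
  refine (norm_le_of_primitive hL u.val_ae_eq (fun y hy => val_eq_Lp hL u hy) hx).trans ?_
  rw [embeddingConst, add_mul]
  gcongr <;> exact norm_component_le u _

theorem norm_der_le (hL : 0 < L) (u : H2 L) {x : ℝ} (hx : x ∈ Icc 0 L) :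
    ‖u.der x‖ ≤ embeddingConst L * ‖u‖ := by
  refine (norm_le_of_primitive hL (g := u.der2) u.der_ae_eq (fun y hy => der_eq hL u hy) hx).trans ?_
  rw [embeddingConst, add_mul]
  gcongr <;> exact norm_component_le u _

theorem val_add (hL : 0 < L) (u v : H2 L) {x : ℝ} (hx : x ∈ Icc 0 L) :
    (u + v).val x = u.val x + v.val x := by
  refine eqOn_Icc_of_ae_eq hL (continuousOn_val _)
    (u.continuousOn_val.add v.continuousOn_val) ?_ hx
  filter_upwards [val_ae_eq (u + v), val_ae_eq u, val_ae_eq v,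
    Lp.coeFn_add ((u : PiLp 2 (fun _ : Fin 3 => L2 L)) 0) ((v : PiLp 2 (fun _ : Fin 3 => L2 L)) 0)]
    with y h1 h2 h3 h4
  rw [h1, Pi.add_apply, h2, h3]
  exact h4

theorem der_add (hL : 0 < L) (u v : H2 L) {x : ℝ} (hx : x ∈ Icc 0 L) :
    (u + v).der x = u.der x + v.der x := by
  refine eqOn_Icc_of_ae_eq hL (continuousOn_der _)
    (u.continuousOn_der.add v.continuousOn_der) ?_ hx
  filter_upwards [der_ae_eq (u + v), der_ae_eq u, der_ae_eq v,
    Lp.coeFn_add ((u : PiLp 2 (fun _ : Fin 3 => L2 L)) 1) ((v : PiLp 2 (fun _ : Fin 3 => L2 L)) 1)]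
    with y h1 h2 h3 h4
  rw [h1, Pi.add_apply, h2, h3]
  exact h4

theorem val_smul (hL : 0 < L) (r : ℝ) (u : H2 L) {x : ℝ} (hx : x ∈ Icc 0 L) :
    (r • u).val x = r • u.val x := by
  refine eqOn_Icc_of_ae_eq hL (continuousOn_val _) (u.continuousOn_val.const_smul r) ?_ hx
  filter_upwards [val_ae_eq (r • u), val_ae_eq u,
    Lp.coeFn_smul r ((u : PiLp 2 (fun _ : Fin 3 => L2 L)) 0)] with y h1 h2 h4
  rw [h1, Pi.smul_apply, h2]
  exact h4

theorem der_smul (hL : 0 < L) (r : ℝ) (u : H2 L) {x : ℝ} (hx : x ∈ Icc 0 L) :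
    (r • u).der x = r • u.der x := by
  refine eqOn_Icc_of_ae_eq hL (continuousOn_der _) (u.continuousOn_der.const_smul r) ?_ hx
  filter_upwards [der_ae_eq (r • u), der_ae_eq u,
    Lp.coeFn_smul r ((u : PiLp 2 (fun _ : Fin 3 => L2 L)) 1)] with y h1 h2 h4
  rw [h1, Pi.smul_apply, h2]
  exact h4

/-- Point evaluation on `H²`. -/
def valCLM (hL : 0 < L) {x : ℝ} (hx : x ∈ Icc 0 L) : H2 L →L[ℝ] E3 :=
  LinearMap.mkContinuous
    { toFun := fun u => u.val x
      map_add' := fun u v => val_add hL u v hx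
      map_smul' := fun r u => val_smul hL r u hx } _ fun u => norm_val_le hL u hx

/-- Point evaluation of the derivative on `H²`. -/
def derCLM (hL : 0 < L) {x : ℝ} (hx : x ∈ Icc 0 L) : H2 L →L[ℝ] E3 :=
  LinearMap.mkContinuous
    { toFun := fun u => u.der x
      map_add' := fun u v => der_add hL u v hx
      map_smul' := fun r u => der_smul hL r u hx } _ fun u => norm_der_le hL u hx

/-- The second derivative on `H²`. -/
def der2CLM (L : ℝ) : H2 L →L[ℝ] L2 L :=
  (PiLp.proj 2 (fun _ : Fin 3 => L2 L) 2).comp (sobolevH2 L).subtypeL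

theorem valCLM_apply (hL : 0 < L) {x : ℝ} (hx : x ∈ Icc 0 L) (u : H2 L) :
    valCLM hL hx u = u.val x := rfl

theorem derCLM_apply (hL : 0 < L) {x : ℝ} (hx : x ∈ Icc 0 L) (u : H2 L) :
    derCLM hL hx u = u.der x := rfl

/-- The element of `H²` with given initial values and given second derivative. -/
def ofInitialCLM (hL : 0 < L) : E3 × E3 × L2 L →L[ℝ] H2 L :=
  ((PiLp.continuousLinearEquiv 2 ℝ (fun _ : Fin 3 => L2 L)).symm.toContinuousLinearMap.comp
    (ContinuousLinearMap.pi ![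
      (primitiveCLM L).comp ((ContinuousLinearMap.fst ℝ E3 (E3 × L2 L)).prod
        ((primitiveCLM L).comp (ContinuousLinearMap.snd ℝ E3 (E3 × L2 L)))),
      (primitiveCLM L).comp (ContinuousLinearMap.snd ℝ E3 (E3 × L2 L)),
      (ContinuousLinearMap.snd ℝ E3 (L2 L)).comp
        (ContinuousLinearMap.snd ℝ E3 (E3 × L2 L))])).codRestrict (sobolevH2 L)
  fun p => ⟨isWeakDeriv_primitiveLp hL p.1 (primitiveLp p.2.1 p.2.2),
    isWeakDeriv_primitiveLp hL p.2.1 p.2.2⟩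

theorem der2_ofInitial (hL : 0 < L) (a b : E3) (g : L2 L) :
    (ofInitialCLM hL (a, b, g)).der2 = g := rfl

theorem der_ofInitial (hL : 0 < L) (a b : E3) (g : L2 L) {x : ℝ} (hx : x ∈ Icc 0 L) :
    (ofInitialCLM hL (a, b, g)).der x = b + ∫ t in (0 : ℝ)..x, g t :=
  eqOn_Icc_of_ae_eq hL (continuousOn_der _) (continuousOn_primitive b g)
    ((der_ae_eq (ofInitialCLM hL (a, b, g))).trans (coeFn_primitiveLp b g)) hx

theorem val_ofInitial_zero (hL : 0 < L) (a b : E3) (g : L2 L) :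
    (ofInitialCLM hL (a, b, g)).val 0 = a := by
  have := eqOn_Icc_of_ae_eq hL (continuousOn_val _)
    (continuousOn_primitive a (primitiveLp b g))
    ((val_ae_eq (ofInitialCLM hL (a, b, g))).trans (coeFn_primitiveLp a (primitiveLp b g)))
    (zero_mem hL)
  simpa using this

theorem der_ofInitial_zero (hL : 0 < L) (a b : E3) (g : L2 L) :
    (ofInitialCLM hL (a, b, g)).der 0 = b := by
  rw [der_ofInitial hL a b g (zero_mem hL)]; simp

theorem ext_val {u v : H2 L} (h : ∀ x ∈ Icc 0 L, u.val x = v.val x)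
    (h' : ∀ x ∈ Icc 0 L, u.der x = v.der x) (h2 : u.der2 = v.der2) : u = v := by
  apply Subtype.ext
  ext1 i
  fin_cases i
  · apply Lp.ext
    filter_upwards [val_ae_eq u, val_ae_eq v, ae_mem_Icc] with x h1 h2 hx
    exact h1.symm.trans ((h x hx).trans h2)
  · apply Lp.ext
    filter_upwards [der_ae_eq u, der_ae_eq v, ae_mem_Icc] with x h1 h2 hx
    exact h1.symm.trans ((h' x hx).trans h2)
  · exact h2

theorem ext_initial (hL : 0 < L) {u v : H2 L} (h : u.val 0 = v.val 0) (h' : u.der 0 = v.der 0)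
    (h2 : u.der2 = v.der2) : u = v := by
  have hd : ∀ x ∈ Icc 0 L, u.der x = v.der x := fun x hx => by
    rw [der_eq hL u hx, der_eq hL v hx, h', h2]
  refine ext_val (fun x hx => ?_) hd h2
  rw [val_eq hL u hx, val_eq hL v hx, h]
  congr 1
  exact intervalIntegral.integral_congr fun y hy =>
    hd y (Icc_subset_of_mem (zero_mem hL) hx hy)

theorem ofInitial_self (hL : 0 < L) (u : H2 L) :
    ofInitialCLM hL (u.val 0, u.der 0, u.der2) = u :=
  ext_initial hL (val_ofInitial_zero hL _ _ _) (der_ofInitial_zero hL _ _ _)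
    (der2_ofInitial hL _ _ _)

end H2

/-! ### Weak convergence in normed spaces -/

section Weak

variable {X Y : Type*} [NormedAddCommGroup X] [NormedSpace ℝ X]
  [NormedAddCommGroup Y] [NormedSpace ℝ Y]

theorem weaklyConverges_of_tendsto {u : ℕ → X} {x : X} (h : Tendsto u atTop (𝓝 x)) :
    WeaklyConverges u x := fun f => (f.continuous.tendsto x).comp h

theorem WeaklyConverges.map {u : ℕ → X} {x : X} (h : WeaklyConverges u x) (T : X →L[ℝ] Y) :
    WeaklyConverges (fun n => T (u n)) (T x) := fun f => h (f.comp T)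

theorem WeaklyConverges.comp_tendsto {u : ℕ → X} {x : X} (h : WeaklyConverges u x) {φ : ℕ → ℕ}
    (hφ : Tendsto φ atTop atTop) : WeaklyConverges (u ∘ φ) x := fun f => (h f).comp hφ

theorem WeaklyConverges.tendsto_euclidean {n : ℕ} {u : ℕ → EuclideanSpace ℝ (Fin n)}
    {x : EuclideanSpace ℝ (Fin n)} (h : WeaklyConverges u x) : Tendsto u atTop (𝓝 x) := by
  have h1 : Tendsto (fun k => (EuclideanSpace.equiv (Fin n) ℝ) (u k)) atTop
      (𝓝 ((EuclideanSpace.equiv (Fin n) ℝ) x)) :=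
    tendsto_pi_nhds.2 fun i => h (EuclideanSpace.proj i)
  have h2 := ((EuclideanSpace.equiv (Fin n) ℝ).symm.continuous.tendsto _).comp h1
  simpa [Function.comp_def] using h2

/-- Uniform boundedness principle in the bidual, where the images of the `u n` are pointwise bounded
and have the same norms. -/
theorem WeaklyConverges.exists_norm_le {u : ℕ → X} {x : X} (h : WeaklyConverges u x) :
    ∃ C, 0 ≤ C ∧ ∀ n, ‖u n‖ ≤ C := by
  obtain ⟨C, hC⟩ := banach_steinhaus
    (g := fun n => NormedSpace.inclusionInDoubleDualLi ℝ (u n)) (fun f => by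
      obtain ⟨C, hC⟩ := (h f).norm.bddAbove_range
      exact ⟨C, fun n => hC ⟨n, rfl⟩⟩)
  refine ⟨C, (norm_nonneg _).trans (hC 0), fun n => ?_⟩
  have := hC n
  rwa [(NormedSpace.inclusionInDoubleDualLi ℝ).norm_map] at this

/-- Bounded sequences in a separable Hilbert space have weakly convergent subsequences. -/
theorem exists_subseq_weaklyConverges {H : Type*} [NormedAddCommGroup H] [InnerProductSpace ℝ H]
    [CompleteSpace H] [TopologicalSpace.SeparableSpace H] {u : ℕ → H} {C : ℝ}
    (hu : ∀ n, ‖u n‖ ≤ C) :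
    ∃ (φ : ℕ → ℕ) (x : H), StrictMono φ ∧ WeaklyConverges (u ∘ φ) x := by
  -- The Riesz isomorphism turns weak convergence in H into weak-* convergence in its dual, where
  -- balls are sequentially compact by separability.
  obtain ⟨a, -, φ, hφ, ha⟩ := WeakDual.isSeqCompact_closedBall ℝ H 0 C
    (x := fun n => StrongDual.toWeakDual (InnerProductSpace.toDual ℝ H (u n))) (fun n => by
      simpa using hu n)
  refine ⟨φ, (InnerProductSpace.toDual ℝ H).symm (WeakDual.toStrongDual a), hφ, fun f => ?_⟩
  have h1 := ((WeakDual.eval_continuous ((InnerProductSpace.toDual ℝ H).symm f)).tendsto a).comp ha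
  have e1 : ∀ z : H, f z = inner ℝ z ((InnerProductSpace.toDual ℝ H).symm f) := fun z => by
    rw [real_inner_comm, InnerProductSpace.toDual_symm_apply]
  rw [e1, InnerProductSpace.toDual_symm_apply]
  refine h1.congr fun n => ?_
  rw [e1]
  rfl

end Weak

/-! ### Stabilized quadratic forms -/

section Quadratic

variable {H K : Type*} [NormedAddCommGroup H] [InnerProductSpace ℝ H]
  [NormedAddCommGroup K] [InnerProductSpace ℝ K]

/-- The quadratic form `½ (‖f‖² - γ ‖Q f‖²)`. -/
def stabilizedForm (γ : ℝ) (Q : H →L[ℝ] K) (f : H) : ℝ :=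
  1 / 2 * (‖f‖ ^ 2 - γ * ‖Q f‖ ^ 2)

theorem tendsto_stabilizedForm {γ : ℕ → ℝ} {Q : ℕ → H →L[ℝ] K} {f : ℕ → H} {γ₀ : ℝ}
    {Q₀ : H →L[ℝ] K} {f₀ : H} (hγ : Tendsto γ atTop (𝓝 γ₀)) (hQ : Tendsto Q atTop (𝓝 Q₀))
    (hf : Tendsto f atTop (𝓝 f₀)) :
    Tendsto (fun n => stabilizedForm (γ n) (Q n) (f n)) atTop (𝓝 (stabilizedForm γ₀ Q₀ f₀)) :=
  by
  have h : Tendsto (fun n => Q n (f n)) atTop (𝓝 (Q₀ f₀)) :=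
    ((isBoundedBilinearMap_apply (𝕜 := ℝ)).continuous.tendsto (Q₀, f₀)).comp (hQ.prodMk_nhds hf)
  exact ((hf.norm.pow 2).sub (hγ.mul (h.norm.pow 2))).const_mul _

theorem stabilizedForm_nonneg {γ : ℝ} (h0 : 0 ≤ γ) (h1 : γ ≤ 1) {Q : H →L[ℝ] K}
    (hQ : ‖Q‖ ≤ 1) (f : H) : 0 ≤ stabilizedForm γ Q f := by
  have h2 : ‖Q f‖ ≤ ‖f‖ := by simpa using Q.le_of_opNorm_le hQ f
  have h3 : ‖Q f‖ ^ 2 ≤ ‖f‖ ^ 2 := by gcongr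
  unfold stabilizedForm
  nlinarith [sq_nonneg ‖Q f‖, mul_nonneg h0 (sub_nonneg.2 h3)]

theorem norm_sq_le_stabilizedForm {γ : ℝ} (h0 : 0 ≤ γ) {Q : H →L[ℝ] K}
    (hQ : ‖Q‖ ≤ 1) (f : H) : (1 - γ) / 2 * ‖f‖ ^ 2 ≤ stabilizedForm γ Q f := by
  have h2 : ‖Q f‖ ≤ ‖f‖ := by simpa using Q.le_of_opNorm_le hQ f
  have h3 : ‖Q f‖ ^ 2 ≤ ‖f‖ ^ 2 := by gcongr
  unfold stabilizedForm
  nlinarith [mul_nonneg h0 (sub_nonneg.2 h3)]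

/-- Weak lower semicontinuity with varying coefficients: the form is bounded below by a sequence
converging to its value at the limit. -/
theorem exists_tendsto_le_stabilizedForm {γ : ℕ → ℝ} {Q : ℕ → H →L[ℝ] K} {f : ℕ → H} {γ₀ : ℝ}
    {Q₀ : H →L[ℝ] K} {f₀ : H} (h0 : ∀ n, 0 ≤ γ n) (h1 : ∀ n, γ n ≤ 1) (hQ1 : ∀ n, ‖Q n‖ ≤ 1)
    (hγ : Tendsto γ atTop (𝓝 γ₀)) (hQ : Tendsto Q atTop (𝓝 Q₀))
    (hf : WeaklyConverges f f₀) :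
    ∃ a : ℕ → ℝ, Tendsto a atTop (𝓝 (stabilizedForm γ₀ Q₀ f₀)) ∧
      ∀ n, a n ≤ stabilizedForm (γ n) (Q n) (f n) := by
  obtain ⟨C, hC0, hC⟩ := hf.exists_norm_le
  -- The form is expanded around f₀, and the quadratic remainder, its value at f n - f₀, is dropped
  -- because it is nonnegative. The remaining cross terms tend to zero.
  refine ⟨fun n => stabilizedForm (γ n) (Q n) f₀ + (inner ℝ f₀ (f n - f₀)
    - γ n * inner ℝ (Q n f₀) (Q n (f n - f₀))), ?_, fun n => ?_⟩
  · have t1 : Tendsto (fun n => inner ℝ f₀ (f n - f₀)) atTop (𝓝 0) := by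
      have := hf (innerSL ℝ f₀)
      simp only [innerSL_apply_apply] at this
      simpa [inner_sub_right] using this.sub_const (inner ℝ f₀ f₀)
    have t2 : Tendsto (fun n => inner ℝ (Q₀ f₀) (Q₀ (f n - f₀))) atTop (𝓝 0) := by
      have := hf ((innerSL ℝ (Q₀ f₀)).comp Q₀)
      simp only [ContinuousLinearMap.comp_apply, innerSL_apply_apply] at this
      simpa [inner_sub_right, map_sub] using this.sub_const (inner ℝ (Q₀ f₀) (Q₀ f₀))
    -- Replacing Q n by Q₀ costs only ‖Q n - Q₀‖ times bounded factors, since weakly convergent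
    -- sequences are bounded.
    have t3 : Tendsto (fun n => inner ℝ (Q n f₀) (Q n (f n - f₀))
        - inner ℝ (Q₀ f₀) (Q₀ (f n - f₀))) atTop (𝓝 0) := by
      have hb : Tendsto (fun n => ‖Q n - Q₀‖ * ‖f₀‖ * (1 * (C + ‖f₀‖))
          + ‖Q₀ f₀‖ * (‖Q n - Q₀‖ * (C + ‖f₀‖))) atTop (𝓝 0) := by
        have hz := tendsto_iff_norm_sub_tendsto_zero.1 hQ
        simpa using ((hz.mul_const ‖f₀‖).mul_const (1 * (C + ‖f₀‖))).add
          ((hz.mul_const (C + ‖f₀‖)).const_mul ‖Q₀ f₀‖)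
      refine squeeze_zero_norm (fun n => ?_) hb
      have e : inner ℝ (Q n f₀) (Q n (f n - f₀)) - inner ℝ (Q₀ f₀) (Q₀ (f n - f₀))
          = inner ℝ ((Q n - Q₀) f₀) (Q n (f n - f₀))
            + inner ℝ (Q₀ f₀) ((Q n - Q₀) (f n - f₀)) := by
        simp only [sub_apply, inner_sub_left, inner_sub_right]
        ring
      have hd : ‖f n - f₀‖ ≤ C + ‖f₀‖ := (norm_sub_le _ _).trans (by gcongr; exact hC n)
      rw [e]
      refine (norm_add_le _ _).trans (add_le_add ?_ ?_)
      · refine (norm_inner_le_norm _ _).trans ?_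
        gcongr
        · exact (Q n - Q₀).le_opNorm _
        · exact ((Q n).le_of_opNorm_le (hQ1 n) _).trans (by gcongr)
      · refine (norm_inner_le_norm _ _).trans ?_
        gcongr
        exact ((Q n - Q₀).le_opNorm _).trans (by gcongr)
    have t4 := (tendsto_stabilizedForm hγ hQ (tendsto_const_nhds (x := f₀))).add
      (t1.sub (hγ.mul (t3.add t2)))
    simpa using t4
  · have hp := stabilizedForm_nonneg (h0 n) (h1 n) (hQ1 n) (f n - f₀)
    have e : stabilizedForm (γ n) (Q n) (f n) = stabilizedForm (γ n) (Q n) f₀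
        + (inner ℝ f₀ (f n - f₀) - γ n * inner ℝ (Q n f₀) (Q n (f n - f₀)))
        + stabilizedForm (γ n) (Q n) (f n - f₀) := by
      have e1 : f n = f₀ + (f n - f₀) := by abel
      have e2 : Q n (f n) = Q n f₀ + Q n (f n - f₀) := by rw [← map_add, ← e1]
      unfold stabilizedForm
      rw [e2]
      nth_rewrite 1 [e1]
      rw [norm_add_sq_real, norm_add_sq_real]
      ring
    linarith

end Quadratic

/-! ### The normal component as an operator on `L²` -/

theorem memLp_inner_field {N : ℝ → E3} (hN : AEStronglyMeasurable N (intervalMeasure L))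
    (hb : ∀ x, ‖N x‖ ≤ 1) (f : L2 L) :
    MemLp (fun x => inner ℝ (f x) (N x)) 2 (intervalMeasure L) := by
  refine (Lp.memLp f).mono ((Lp.aestronglyMeasurable f).inner hN) (Eventually.of_forall fun x => ?_)
  refine (norm_inner_le_norm _ _).trans ?_
  exact mul_le_of_le_one_right (norm_nonneg _) (hb x)

/-- The operator `f ↦ f ⬝ N` for a measurable field `N` with values in the unit ball. -/
def fieldComponent {N : ℝ → E3} (hN : AEStronglyMeasurable N (intervalMeasure L))
    (hb : ∀ x, ‖N x‖ ≤ 1) : L2 L →L[ℝ] Lp ℝ 2 (intervalMeasure L) :=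
  LinearMap.mkContinuous
    { toFun := fun f => (memLp_inner_field hN hb f).toLp _
      map_add' := by
        intro f g
        apply Lp.ext
        filter_upwards [(memLp_inner_field hN hb (f + g)).coeFn_toLp,
          (memLp_inner_field hN hb f).coeFn_toLp, (memLp_inner_field hN hb g).coeFn_toLp,
          Lp.coeFn_add ((memLp_inner_field hN hb f).toLp _) ((memLp_inner_field hN hb g).toLp _),
          Lp.coeFn_add f g] with x h1 h2 h3 h4 h5
        rw [h1, h4, Pi.add_apply, h2, h3, h5, Pi.add_apply, inner_add_left]
      map_smul' := by
        intro r f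
        apply Lp.ext
        filter_upwards [(memLp_inner_field hN hb (r • f)).coeFn_toLp,
          (memLp_inner_field hN hb f).coeFn_toLp,
          Lp.coeFn_smul r ((memLp_inner_field hN hb f).toLp _), Lp.coeFn_smul r f]
          with x h1 h2 h4 h5
        rw [h1, RingHom.id_apply, h4, Pi.smul_apply, h2, h5, Pi.smul_apply, real_inner_smul_left,
          smul_eq_mul] }
    1 (fun f => by
      rw [one_mul]
      refine Lp.norm_le_norm_of_ae_le ?_
      filter_upwards [(memLp_inner_field hN hb f).coeFn_toLp] with x hx
      change ‖((memLp_inner_field hN hb f).toLp _) x‖ ≤ _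
      rw [hx]
      exact (norm_inner_le_norm _ _).trans (mul_le_of_le_one_right (norm_nonneg _) (hb x)))

theorem coeFn_fieldComponent {N : ℝ → E3} (hN : AEStronglyMeasurable N (intervalMeasure L))
    (hb : ∀ x, ‖N x‖ ≤ 1) (f : L2 L) :
    fieldComponent hN hb f =ᵐ[intervalMeasure L] fun x => inner ℝ (f x) (N x) :=
  (memLp_inner_field hN hb f).coeFn_toLp

theorem norm_fieldComponent_le {N : ℝ → E3} (hN : AEStronglyMeasurable N (intervalMeasure L))
    (hb : ∀ x, ‖N x‖ ≤ 1) : ‖fieldComponent hN hb‖ ≤ 1 :=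
  LinearMap.mkContinuous_norm_le _ zero_le_one _

/-- Used to turn uniform convergence of normal fields into operator norm convergence. -/
theorem norm_fieldComponent_sub_le {N N' : ℝ → E3}
    (hN : AEStronglyMeasurable N (intervalMeasure L)) (hb : ∀ x, ‖N x‖ ≤ 1)
    (hN' : AEStronglyMeasurable N' (intervalMeasure L)) (hb' : ∀ x, ‖N' x‖ ≤ 1) {ε : ℝ}
    (hε : 0 ≤ ε) (h : ∀ x ∈ Icc 0 L, ‖N x - N' x‖ ≤ ε) :
    ‖fieldComponent hN hb - fieldComponent hN' hb'‖ ≤ ε := by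
  refine ContinuousLinearMap.opNorm_le_bound _ hε fun f => ?_
  refine Lp.norm_le_mul_norm_of_ae_le_mul ?_
  filter_upwards [coeFn_fieldComponent hN hb f, coeFn_fieldComponent hN' hb' f,
    Lp.coeFn_sub (fieldComponent hN hb f) (fieldComponent hN' hb' f), ae_mem_Icc] with x h1 h2 h3 hx
  rw [sub_apply, h3, Pi.sub_apply, h1, h2, ← inner_sub_right]
  refine (norm_inner_le_norm _ _).trans ?_
  rw [mul_comm]
  exact mul_le_mul_of_nonneg_right (h x hx) (norm_nonneg _)

theorem norm_sq_eq_integral {E : Type*} [NormedAddCommGroup E] [InnerProductSpace ℝ E]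
    (f : Lp E 2 (intervalMeasure L)) : ‖f‖ ^ 2 = ∫ x in Ioo 0 L, ‖f x‖ ^ 2 := by
  rw [← real_inner_self_eq_norm_sq, L2.inner_def]
  simp only [real_inner_self_eq_norm_sq]

theorem integrable_norm_sq {E : Type*} [NormedAddCommGroup E]
    (f : Lp E 2 (intervalMeasure L)) : Integrable (fun x => ‖f x‖ ^ 2) (intervalMeasure L) :=
  (Lp.memLp f).integrable_norm_pow (by norm_num)

theorem norm_unitNormal_le (Φ : E3 → ℝ) (p : E3) : ‖unitNormal Φ p‖ ≤ 1 := by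
  rw [unitNormal, norm_smul, norm_inv, norm_norm]
  exact inv_mul_le_one

theorem continuous_gradient {Φ : E3 → ℝ} (hΦ : ContDiff ℝ 1 Φ) : Continuous (gradient Φ) :=
  (InnerProductSpace.toDual ℝ E3).symm.continuous.comp (hΦ.continuous_fderiv (by norm_num))

theorem continuousAt_unitNormal {Φ : E3 → ℝ} (hΦ : ContDiff ℝ 1 Φ) {p : E3}
    (hp : gradient Φ p ≠ 0) : ContinuousAt (unitNormal Φ) p :=
  ((continuous_gradient hΦ).continuousAt.norm.inv₀ (norm_ne_zero_iff.2 hp)).smul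
    (continuous_gradient hΦ).continuousAt

theorem measurable_unitNormal {Φ : E3 → ℝ} (hΦ : ContDiff ℝ 1 Φ) : Measurable (unitNormal Φ) :=
  (continuous_gradient hΦ).measurable.norm.inv.smul (continuous_gradient hΦ).measurable

theorem aestronglyMeasurable_normal {Φ : E3 → ℝ} (hΦ : ContDiff ℝ 1 Φ) (u : H2 L) :
    AEStronglyMeasurable (fun x => unitNormal Φ (u.val x)) (intervalMeasure L) := by
  have h1 : AEMeasurable u.val (intervalMeasure L) :=
    (memLp_of_continuousOn u.continuousOn_val).1.aemeasurable
  exact ((measurable_unitNormal hΦ).comp_aemeasurable h1).aestronglyMeasurable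

/-- The operator `f ↦ f ⬝ n_S(u)`. -/
def normalComponent {Φ : E3 → ℝ} (hΦ : ContDiff ℝ 1 Φ) (u : H2 L) :
    L2 L →L[ℝ] Lp ℝ 2 (intervalMeasure L) :=
  fieldComponent (aestronglyMeasurable_normal hΦ u) fun _ => norm_unitNormal_le Φ _

theorem norm_normalComponent_le {Φ : E3 → ℝ} (hΦ : ContDiff ℝ 1 Φ) (u : H2 L) :
    ‖normalComponent hΦ u‖ ≤ 1 := norm_fieldComponent_le _ _

theorem norm_sq_normalComponent {Φ : E3 → ℝ} (hΦ : ContDiff ℝ 1 Φ) (u : H2 L) :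
    ‖normalComponent hΦ u u.der2‖ ^ 2
      = ∫ x in Ioo 0 L, |inner ℝ (u.der2 x) (unitNormal Φ (u.val x))| ^ 2 := by
  rw [norm_sq_eq_integral]
  refine integral_congr_ae ?_
  filter_upwards [coeFn_fieldComponent (aestronglyMeasurable_normal hΦ u)
    (fun _ => norm_unitNormal_le Φ _) u.der2] with x hx
  rw [normalComponent, hx, Real.norm_eq_abs]

/-- Reduces the convergence arguments to Hilbert space statements about `stabilizedForm`. -/
theorem stabilizedIntegral_eq {Φ : E3 → ℝ} (hΦ : ContDiff ℝ 1 Φ) (γ : ℝ) (u : H2 L) :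
    stabilizedIntegral Φ γ u = stabilizedForm γ (normalComponent hΦ u) u.der2 := by
  have hi : Integrable (fun x => γ * |inner ℝ (u.der2 x) (unitNormal Φ (u.val x))| ^ 2)
      (intervalMeasure L) := by
    refine Integrable.const_mul ?_ γ
    simpa only [Real.norm_eq_abs] using
      (memLp_inner_field (aestronglyMeasurable_normal hΦ u)
        (fun _ => norm_unitNormal_le Φ _) u.der2).integrable_norm_pow (by norm_num)
  rw [stabilizedIntegral, stabilizedForm, norm_sq_normalComponent, norm_sq_eq_integral,
    integral_sub (integrable_norm_sq u.der2) hi, integral_const_mul]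

/-! ### Uniform convergence -/

/-- The common Hölder bound makes the family equicontinuous, and pointwise convergence of an
equicontinuous sequence on a compact set is uniform. -/
theorem tendstoUniformlyOn_of_holder {F : ℕ → ℝ → E3} {G : ℝ → E3} {C : ℝ}
    (hF : ∀ n, ∀ x ∈ Icc 0 L, ∀ y ∈ Icc 0 L, ‖F n y - F n x‖ ≤ √|y - x| * C)
    (hG : ContinuousOn G (Icc 0 L))
    (h : ∀ x ∈ Icc 0 L, Tendsto (fun n => F n x) atTop (𝓝 (G x))) :
    TendstoUniformlyOn F G atTop (Icc 0 L) := by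
  rw [← tendstoLocallyUniformlyOn_iff_tendstoUniformlyOn_of_compact isCompact_Icc,
    Metric.tendstoLocallyUniformlyOn_iff]
  intro ε hε x hx
  have hc : ContinuousAt (fun y => √|y - x| * C) x := by fun_prop
  have h1 : ∀ᶠ y in 𝓝[Icc 0 L] x, √|y - x| * C < ε / 3 := by
    refine nhdsWithin_le_nhds (hc.eventually_lt continuousAt_const ?_)
    simp [hε]
  have h2 : ∀ᶠ y in 𝓝[Icc 0 L] x, dist (G y) (G x) < ε / 3 :=
    Metric.tendsto_nhds.1 (hG x hx) _ (by positivity)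
  refine ⟨{y | y ∈ Icc 0 L ∧ √|y - x| * C < ε / 3 ∧ dist (G y) (G x) < ε / 3}, ?_, ?_⟩
  · filter_upwards [h1, h2, self_mem_nhdsWithin] with y a b c using ⟨c, a, b⟩
  · filter_upwards [Metric.tendsto_nhds.1 (h x hx) (ε / 3) (by positivity)] with n hn y hy
    have a1 := (hF n x hx y hy.1).trans_lt hy.2.1
    rw [← dist_eq_norm] at a1
    have a2 := hy.2.2
    have a3 := dist_triangle4 (G y) (G x) (F n x) (F n y)
    rw [dist_comm] at hn
    rw [dist_comm] at a1
    linarith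

namespace H2

theorem norm_val_sub_le (hL : 0 < L) (u : H2 L) {x y : ℝ} (hx : x ∈ Icc 0 L) (hy : y ∈ Icc 0 L) :
    ‖u.val y - u.val x‖ ≤ √|y - x| * ‖u‖ := by
  have e : u.val y - u.val x
      = ∫ t in x..y, (u : PiLp 2 (fun _ : Fin 3 => L2 L)) 1 t := by
    rw [val_sub hL u hx hy, intervalIntegral_congr_Lp u.der_ae_eq hx hy]
  rw [e]
  exact (norm_intervalIntegral_le _ hx hy).trans
    (mul_le_mul_of_nonneg_left (norm_component_le u 1) (Real.sqrt_nonneg _))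

theorem norm_der_sub_le (hL : 0 < L) (u : H2 L) {x y : ℝ} (hx : x ∈ Icc 0 L) (hy : y ∈ Icc 0 L) :
    ‖u.der y - u.der x‖ ≤ √|y - x| * ‖u‖ := by
  rw [der_sub hL u hx hy]
  exact (norm_intervalIntegral_le _ hx hy).trans
    (mul_le_mul_of_nonneg_left (norm_component_le u 2) (Real.sqrt_nonneg _))

theorem tendstoUniformlyOn_val (hL : 0 < L) {u : ℕ → H2 L} {u₀ : H2 L}
    (h : WeaklyConverges u u₀) :
    TendstoUniformlyOn (fun n => (u n).val) u₀.val atTop (Icc 0 L) := by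
  obtain ⟨C, -, hC⟩ := h.exists_norm_le
  refine tendstoUniformlyOn_of_holder (C := C) (fun n x hx y hy => ?_) u₀.continuousOn_val
    fun x hx => (h.map (valCLM hL hx)).tendsto_euclidean
  exact (norm_val_sub_le hL (u n) hx hy).trans
    (mul_le_mul_of_nonneg_left (hC n) (Real.sqrt_nonneg _))

theorem tendstoUniformlyOn_der (hL : 0 < L) {u : ℕ → H2 L} {u₀ : H2 L}
    (h : WeaklyConverges u u₀) :
    TendstoUniformlyOn (fun n => (u n).der) u₀.der atTop (Icc 0 L) := by
  obtain ⟨C, -, hC⟩ := h.exists_norm_le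
  refine tendstoUniformlyOn_of_holder (C := C) (fun n x hx y hy => ?_) u₀.continuousOn_der
    fun x hx => (h.map (derCLM hL hx)).tendsto_euclidean
  exact (norm_der_sub_le hL (u n) hx hy).trans
    (mul_le_mul_of_nonneg_left (hC n) (Real.sqrt_nonneg _))

/-- Values along convergent sequences of points converge under uniform convergence. -/
theorem tendsto_apply_seq {F : ℕ → ℝ → E3} {G : ℝ → E3}
    (h : TendstoUniformlyOn F G atTop (Icc 0 L)) (hG : ContinuousOn G (Icc 0 L)) {x : ℝ}
    (hx : x ∈ Icc 0 L) {y : ℕ → ℝ} (hy : ∀ n, y n ∈ Icc 0 L) (hyx : Tendsto y atTop (𝓝 x)) :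
    Tendsto (fun n => F n (y n)) atTop (𝓝 (G x)) := by
  have h1 : Tendsto (fun n => G (y n)) atTop (𝓝 (G x)) :=
    (hG x hx).tendsto.comp (tendsto_nhdsWithin_iff.2 ⟨hyx, Eventually.of_forall hy⟩)
  rw [Metric.tendsto_nhds] at h1 ⊢
  intro ε hε
  filter_upwards [Metric.tendstoUniformlyOn_iff.1 h (ε / 2) (by positivity),
    h1 (ε / 2) (by positivity)] with n a b
  have c := dist_triangle_left (F n (y n)) (G x) (G (y n))
  have := a (y n) (hy n)
  linarith

end H2

/-- The normal fields along weakly convergent curves converge, if the limit lies on the surface. -/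
theorem tendsto_normalComponent (hL : 0 < L) {Φ : E3 → ℝ} (hΦ : ContDiff ℝ 1 Φ) {u : ℕ → H2 L}
    {u₀ : H2 L} (h : WeaklyConverges u u₀) (hu : ∀ x ∈ Icc 0 L, gradient Φ (u₀.val x) ≠ 0) :
    Tendsto (fun n => normalComponent hΦ (u n)) atTop (𝓝 (normalComponent hΦ u₀)) := by
  rw [Metric.tendsto_nhds]
  intro ε hε
  have hK : IsCompact (u₀.val '' Icc 0 L) := isCompact_Icc.image_of_continuousOn u₀.continuousOn_val
  -- The field n_S may be discontinuous away from S. It is continuous at each point of the compact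
  -- image of u₀, and this gives uniform closeness even when the second point is off the image.
  have hmem := hK.uniformContinuousAt_of_continuousAt (unitNormal Φ)
    (fun p hp => by
      obtain ⟨x, hx, rfl⟩ := hp
      exact continuousAt_unitNormal hΦ (hu x hx)) (Metric.dist_mem_uniformity (half_pos hε))
  obtain ⟨δ, hδ, hsub⟩ := Metric.mem_uniformity_dist.1 hmem
  filter_upwards [Metric.tendstoUniformlyOn_iff.1 (H2.tendstoUniformlyOn_val hL h) δ hδ] with n hn
  rw [dist_eq_norm]
  refine (norm_fieldComponent_sub_le _ _ _ _ (half_pos hε).le fun x hx => ?_).trans_lt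
    (half_lt_self hε)
  have := hsub (hn x hx) (mem_image_of_mem _ hx)
  simp only [mem_ofPred_eq] at this
  rw [← dist_eq_norm, dist_comm]
  exact le_of_lt this

/-! ### Convergence of constrained energies -/

open Classical in
/-- The stabilized bending energy, extended by `+∞` outside of the constraint set `A`. -/
def constrainedEnergy (A : Set (H2 L)) (Φ : E3 → ℝ) (γ : ℝ) (u : H2 L) : EReal :=
  if u ∈ A then (stabilizedIntegral Φ γ u : EReal) else ⊤

theorem constrainedEnergy_of_mem {A : Set (H2 L)} {Φ : E3 → ℝ} {γ : ℝ} {u : H2 L} (h : u ∈ A) :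
    constrainedEnergy A Φ γ u = (stabilizedIntegral Φ γ u : EReal) := if_pos h

theorem constrainedEnergy_of_notMem {A : Set (H2 L)} {Φ : E3 → ℝ} {γ : ℝ} {u : H2 L}
    (h : u ∉ A) : constrainedEnergy A Φ γ u = ⊤ := if_neg h

theorem mem_of_constrainedEnergy_lt_top {A : Set (H2 L)} {Φ : E3 → ℝ} {γ : ℝ} {u : H2 L}
    (h : constrainedEnergy A Φ γ u < ⊤) : u ∈ A := by
  by_contra hn
  rw [constrainedEnergy_of_notMem hn] at h
  exact lt_irrefl _ h

theorem stabilizedIntegral_le_constrainedEnergy (A : Set (H2 L)) (Φ : E3 → ℝ) (γ : ℝ) (u : H2 L) :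
    (stabilizedIntegral Φ γ u : EReal) ≤ constrainedEnergy A Φ γ u := by
  by_cases h : u ∈ A
  · rw [constrainedEnergy_of_mem h]
  · rw [constrainedEnergy_of_notMem h]; exact le_top

/-- Constraint sets `A n` that are consistent with a limiting constraint set `A₀`: weak limits of
admissible curves are admissible. -/
def WeaklyClosedInLimit (A : ℕ → Set (H2 L)) (A₀ : Set (H2 L)) : Prop :=
  ∀ (φ : ℕ → ℕ) (u : ℕ → H2 L) (u₀ : H2 L), Tendsto φ atTop atTop → (∀ n, u n ∈ A (φ n)) →
    WeaklyConverges u u₀ → u₀ ∈ A₀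

theorem WeaklyClosedInLimit.comp {A : ℕ → Set (H2 L)} {A₀ : Set (H2 L)}
    (h : WeaklyClosedInLimit A A₀) {ψ : ℕ → ℕ} (hψ : Tendsto ψ atTop atTop) :
    WeaklyClosedInLimit (fun n => A (ψ n)) A₀ :=
  fun φ u u₀ hφ hu hw => h (ψ ∘ φ) u u₀ (hψ.comp hφ) hu hw

section

variable {Φ : E3 → ℝ} {A : ℕ → Set (H2 L)} {A₀ : Set (H2 L)} {γ : ℕ → ℝ} {γ₀ : ℝ}

/-- If u n is admissible infinitely often, then u₀ is admissible and semicontinuity of the form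
applies; otherwise the liminf is +∞. The lower bound for the integral needs no admissibility of u n,
so it is used along the whole sequence. -/
theorem constrainedEnergy_le_liminf (hL : 0 < L) (hΦ : ContDiff ℝ 1 Φ)
    (hγ01 : ∀ n, 0 ≤ γ n ∧ γ n ≤ 1) (hγ : Tendsto γ atTop (𝓝 γ₀))
    (hreg : ∀ u ∈ A₀, ∀ x ∈ Icc 0 L, gradient Φ (u.val x) ≠ 0)
    (hA : WeaklyClosedInLimit A A₀) {u : ℕ → H2 L} {u₀ : H2 L} (hu : WeaklyConverges u u₀) :
    constrainedEnergy A₀ Φ γ₀ u₀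
      ≤ liminf (fun n => constrainedEnergy (A n) Φ (γ n) (u n)) atTop := by
  by_cases hf : ∃ᶠ n in atTop, u n ∈ A n
  · obtain ⟨φ, hφ, hφA⟩ := extraction_of_frequently_atTop hf
    -- Only a subsequence is known to be admissible, which is why `WeaklyClosedInLimit` allows a
    -- reindexing.
    have hu₀ : u₀ ∈ A₀ :=
      hA φ (u ∘ φ) u₀ hφ.tendsto_atTop hφA (hu.comp_tendsto hφ.tendsto_atTop)
    obtain ⟨a, ha, hle⟩ := exists_tendsto_le_stabilizedForm (fun n => (hγ01 n).1)
      (fun n => (hγ01 n).2) (fun n => norm_normalComponent_le hΦ (u n)) hγ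
      (tendsto_normalComponent hL hΦ hu (hreg u₀ hu₀)) (hu.map (H2.der2CLM L))
    rw [constrainedEnergy_of_mem hu₀, stabilizedIntegral_eq hΦ]
    have ha' : Tendsto (fun n => (a n : EReal)) atTop
        (𝓝 (stabilizedForm γ₀ (normalComponent hΦ u₀) u₀.der2 : EReal)) :=
      (continuous_coe_real_ereal.tendsto _).comp ha
    rw [← ha'.liminf_eq]
    refine liminf_le_liminf (Eventually.of_forall fun n => ?_)
    refine le_trans ?_ (stabilizedIntegral_le_constrainedEnergy (A n) Φ (γ n) (u n))
    rw [stabilizedIntegral_eq hΦ]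
    exact EReal.coe_le_coe_iff.2 (hle n)
  · rw [not_frequently] at hf
    have : liminf (fun n => constrainedEnergy (A n) Φ (γ n) (u n)) atTop = ⊤ := by
      rw [liminf_congr (hf.mono fun n hn => constrainedEnergy_of_notMem hn), liminf_const]
    rw [this]
    exact le_top

theorem tendsto_constrainedEnergy (hL : 0 < L) (hΦ : ContDiff ℝ 1 Φ)
    (hγ : Tendsto γ atTop (𝓝 γ₀))
    (hreg : ∀ u ∈ A₀, ∀ x ∈ Icc 0 L, gradient Φ (u.val x) ≠ 0)
    {u : ℕ → H2 L} {u₀ : H2 L} (hu₀ : u₀ ∈ A₀) (huA : ∀ n, u n ∈ A n)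
    (hu : Tendsto u atTop (𝓝 u₀)) :
    Tendsto (fun n => constrainedEnergy (A n) Φ (γ n) (u n)) atTop
      (𝓝 (constrainedEnergy A₀ Φ γ₀ u₀)) := by
  rw [constrainedEnergy_of_mem hu₀]
  simp only [fun n => constrainedEnergy_of_mem (Φ := Φ) (γ := γ n) (huA n), stabilizedIntegral_eq hΦ]
  exact (continuous_coe_real_ereal.tendsto _).comp (tendsto_stabilizedForm hγ
    (tendsto_normalComponent hL hΦ (weaklyConverges_of_tendsto hu) (hreg u₀ hu₀))
    (((H2.der2CLM L).continuous.tendsto u₀).comp hu))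

theorem gammaConverges_constrainedEnergy (hL : 0 < L) (hΦ : ContDiff ℝ 1 Φ)
    (hγ01 : ∀ n, 0 ≤ γ n ∧ γ n ≤ 1) (hγ : Tendsto γ atTop (𝓝 γ₀))
    (hreg : ∀ u ∈ A₀, ∀ x ∈ Icc 0 L, gradient Φ (u.val x) ≠ 0)
    (hA : WeaklyClosedInLimit A A₀)
    (hrec : ∀ u ∈ A₀, ∃ v : ℕ → H2 L, (∀ n, v n ∈ A n) ∧ Tendsto v atTop (𝓝 u)) :
    GammaConverges (fun n => constrainedEnergy (A n) Φ (γ n)) (constrainedEnergy A₀ Φ γ₀) := by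
  refine ⟨fun u x hu => constrainedEnergy_le_liminf hL hΦ hγ01 hγ hreg hA hu, fun x => ?_⟩
  by_cases hx : x ∈ A₀
  · obtain ⟨v, hv, hvx⟩ := hrec x hx
    exact ⟨v, hvx, tendsto_constrainedEnergy hL hΦ hγ hreg hx hv hvx⟩
  -- Outside A₀ the constant sequence is a recovery sequence: the liminf inequality forces its
  -- energies to tend to +∞.
  · refine ⟨fun _ => x, tendsto_const_nhds, ?_⟩
    have h := constrainedEnergy_le_liminf hL hΦ hγ01 hγ hreg hA (u := fun _ => x) (u₀ := x)
      (fun f => tendsto_const_nhds)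
    exact tendsto_of_le_liminf_of_limsup_le h
      (by rw [constrainedEnergy_of_notMem hx]; exact le_top)

/-- The quasiminimizers are compared with a strongly convergent sequence of admissible curves
approximating a given y ∈ A₀. Nonemptiness of A₀ makes the minimal value finite. -/
theorem quasiMinimizersConverge_constrainedEnergy (hL : 0 < L) (hΦ : ContDiff ℝ 1 Φ)
    (hγ01 : ∀ n, 0 ≤ γ n ∧ γ n ≤ 1) (hγ : Tendsto γ atTop (𝓝 γ₀))
    (hreg : ∀ u ∈ A₀, ∀ x ∈ Icc 0 L, gradient Φ (u.val x) ≠ 0)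
    (hA : WeaklyClosedInLimit A A₀)
    (hrec : ∀ u ∈ A₀, ∃ v : ℕ → H2 L, (∀ n, v n ∈ A n) ∧ Tendsto v atTop (𝓝 u))
    (hne : A₀.Nonempty) :
    QuasiMinimizersConverge (fun n => constrainedEnergy (A n) Φ (γ n))
      (constrainedEnergy A₀ Φ γ₀) := by
  rintro u ⟨ε, hε, hu⟩ φ x hφ hx
  have hφ' := hφ.tendsto_atTop
  have hle : ∀ y ∈ A₀, constrainedEnergy A₀ Φ γ₀ x ≤ constrainedEnergy A₀ Φ γ₀ y := by
    intro y hy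
    obtain ⟨v, hv, hvy⟩ := hrec y hy
    have t1 := (tendsto_constrainedEnergy hL hΦ hγ hreg hy hv hvy).comp hφ'
    have t2 : Tendsto (fun n => constrainedEnergy (A (φ n)) Φ (γ (φ n)) (v (φ n))
        + (ε (φ n) : EReal)) atTop (𝓝 (constrainedEnergy A₀ Φ γ₀ y + ((0 : ℝ) : EReal))) := by
      -- Addition on `EReal` is continuous at this pair because its second entry is finite.
      have hc : ContinuousAt (fun p : EReal × EReal => p.1 + p.2)
          (constrainedEnergy A₀ Φ γ₀ y, ((0 : ℝ) : EReal)) :=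
        EReal.continuousAt_add (Or.inr (EReal.coe_ne_bot 0)) (Or.inr (EReal.coe_ne_top 0))
      exact hc.tendsto.comp
        (t1.prodMk_nhds ((continuous_coe_real_ereal.tendsto _).comp (hε.comp hφ')))
    rw [EReal.coe_zero, add_zero] at t2
    have h1 := constrainedEnergy_le_liminf hL hΦ (fun n => hγ01 (φ n)) (hγ.comp hφ') hreg
      (hA.comp hφ') hx
    refine h1.trans ?_
    rw [← t2.liminf_eq]
    exact liminf_le_liminf (Eventually.of_forall fun n => hu (φ n) (v (φ n)))
  obtain ⟨y₀, hy₀⟩ := hne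
  refine ⟨(hle y₀ hy₀).trans_lt ?_, fun y => ?_⟩
  · rw [constrainedEnergy_of_mem hy₀]; exact EReal.coe_lt_top _
  · by_cases hy : y ∈ A₀
    · exact hle y hy
    · rw [constrainedEnergy_of_notMem hy]; exact le_top

end

/-! ### Weak compactness in `H²` -/

namespace H2

/-- A curve is determined linearly and continuously by its initial value, initial slope and second
derivative. Compactness is extracted in E3 × E3 (strongly) and in L² (weakly), then transported by
`ofInitialCLM`. -/
theorem exists_subseq_weaklyConverges (hL : 0 < L) {u : ℕ → H2 L} {C : ℝ}
    (hu : ∀ n, ‖u n‖ ≤ C) :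
    ∃ (φ : ℕ → ℕ) (x : H2 L), StrictMono φ ∧ WeaklyConverges (u ∘ φ) x := by
  have : Fact ((2 : ENNReal) ≠ ⊤) := ⟨by norm_num⟩
  have hE : 0 ≤ embeddingConst L := by unfold embeddingConst; positivity
  have h0 := zero_mem hL
  obtain ⟨c, -, φ, hφ, hc⟩ := (isCompact_closedBall (0 : E3 × E3)
    (embeddingConst L * C)).tendsto_subseq (x := fun n => ((u n).val 0, (u n).der 0)) (fun n => by
      rw [mem_closedBall_zero_iff, Prod.norm_mk, max_le_iff]
      exact ⟨(norm_val_le hL (u n) h0).trans (mul_le_mul_of_nonneg_left (hu n) hE),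
        (norm_der_le hL (u n) h0).trans (mul_le_mul_of_nonneg_left (hu n) hE)⟩)
  obtain ⟨ψ, g, hψ, hg⟩ := ElasticCurves.exists_subseq_weaklyConverges
    (u := fun n => (u (φ n)).der2) (C := C) fun n => (norm_component_le _ 2).trans (hu _)
  refine ⟨φ ∘ ψ, ofInitialCLM hL (c.1, c.2, g), hφ.comp hψ, fun f => ?_⟩
  -- A functional on H² splits into a part seeing the initial data and a part seeing u'', so the two
  -- kinds of convergence can be used separately.
  have e : ∀ (a b : E3) (k : L2 L), f (ofInitialCLM hL (a, b, k))
      = f (ofInitialCLM hL (a, b, 0)) + f (ofInitialCLM hL (0, 0, k)) := fun a b k => by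
    have h : ((a, b, k) : E3 × E3 × L2 L) = (a, b, 0) + (0, 0, k) := by
      simp only [Prod.mk_add_mk, add_zero, zero_add]
    rw [h]
    exact ((congrArg f ((ofInitialCLM hL).map_add _ _)).trans (f.map_add _ _))
  have t1 : Tendsto (fun n => f (ofInitialCLM hL ((u (φ (ψ n))).val 0, (u (φ (ψ n))).der 0, 0)))
      atTop (𝓝 (f (ofInitialCLM hL (c.1, c.2, 0)))) := by
    have hcont : Continuous fun p : E3 × E3 => f (ofInitialCLM hL (p.1, p.2, 0)) :=
      f.continuous.comp ((ofInitialCLM hL).continuous.comp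
        (continuous_fst.prodMk (continuous_snd.prodMk continuous_const)))
    have ht := (hcont.tendsto c).comp (hc.comp hψ.tendsto_atTop)
    simp only [Function.comp_def] at ht
    exact ht
  have t2 : Tendsto (fun n => f (ofInitialCLM hL (0, 0, (u (φ (ψ n))).der2)))
      atTop (𝓝 (f (ofInitialCLM hL (0, 0, g)))) :=
    hg ((f.comp (ofInitialCLM hL)).comp ((ContinuousLinearMap.inr ℝ E3 (E3 × L2 L)).comp
      (ContinuousLinearMap.inr ℝ E3 (L2 L))))
  rw [e]
  refine (t1.add t2).congr fun n => ?_
  rw [← e, ofInitial_self]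
  rfl

end H2

theorem boundedEnergyCompact_constrainedEnergy (hL : 0 < L) {Φ : E3 → ℝ} (hΦ : ContDiff ℝ 1 Φ)
    {A : ℕ → Set (H2 L)} {A₀ : Set (H2 L)} {γ : ℕ → ℝ} {γ₀ : ℝ}
    (hγ01 : ∀ n, 0 ≤ γ n ∧ γ n ≤ 1) (hγ : Tendsto γ atTop (𝓝 γ₀))
    (hreg : ∀ u ∈ A₀, ∀ x ∈ Icc 0 L, gradient Φ (u.val x) ≠ 0)
    (hA : WeaklyClosedInLimit A A₀)
    (hcoer : ∀ c : ℝ, ∃ M : ℝ, ∀ n, ∀ u ∈ A n, stabilizedIntegral Φ (γ n) u ≤ c → ‖u‖ ≤ M) :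
    BoundedEnergyCompact (fun n => constrainedEnergy (A n) Φ (γ n))
      (constrainedEnergy A₀ Φ γ₀) := by
  intro u c hu
  obtain ⟨M, hM⟩ := hcoer c
  have hbd : ∀ n, ‖u n‖ ≤ M := fun n => by
    have hn := hu n
    have hmem := mem_of_constrainedEnergy_lt_top (hn.trans_lt (EReal.coe_lt_top c))
    refine hM n (u n) hmem ?_
    simp only [constrainedEnergy_of_mem hmem] at hn
    exact EReal.coe_le_coe_iff.1 hn
  -- The liminf is required along the whole sequence, so a subsequence realizing it is selected
  -- before weak compactness is applied.
  obtain ⟨s, hs, hs'⟩ := exists_seq_tendsto_liminf (f := atTop)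
    (u := fun n => constrainedEnergy (A n) Φ (γ n) (u n))
  obtain ⟨ψ, hψ, hsψ⟩ := strictMono_subseq_of_tendsto_atTop hs'
  obtain ⟨χ, x, hχ, hx⟩ := H2.exists_subseq_weaklyConverges hL (u := u ∘ (s ∘ ψ))
    (fun n => hbd _)
  have hφ : StrictMono (s ∘ ψ ∘ χ) := hsψ.comp hχ
  refine ⟨s ∘ ψ ∘ χ, x, hφ, hx, ?_⟩
  have h1 := constrainedEnergy_le_liminf hL hΦ (fun n => hγ01 ((s ∘ ψ ∘ χ) n))
    (hγ.comp hφ.tendsto_atTop) hreg (hA.comp hφ.tendsto_atTop) hx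
  refine h1.trans_eq ?_
  exact (hs.comp (hψ.comp hχ).tendsto_atTop).liminf_eq

/-! ### A priori bounds -/

namespace H2

/-- The affine curves in `H²`. -/
def affineCLM (hL : 0 < L) : E3 × E3 →L[ℝ] H2 L :=
  (ofInitialCLM hL).comp ((ContinuousLinearMap.fst ℝ E3 E3).prod
    ((ContinuousLinearMap.snd ℝ E3 E3).prod 0))

theorem der2_affine (hL : 0 < L) (p : E3 × E3) : (affineCLM hL p).der2 = 0 := rfl

theorem val_affine_zero (hL : 0 < L) (p : E3 × E3) : (affineCLM hL p).val 0 = p.1 :=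
  val_ofInitial_zero hL _ _ _

theorem der_affine (hL : 0 < L) (p : E3 × E3) {x : ℝ} (hx : x ∈ Icc 0 L) :
    (affineCLM hL p).der x = p.2 := by
  have h : (affineCLM hL p).der 0 = p.2 := der_ofInitial_zero hL _ _ _
  have := der_sub hL (affineCLM hL p) (zero_mem hL) hx
  rw [der2_affine, intervalIntegral_congr_Lp (Lp.coeFn_zero E3 2 _) (zero_mem hL) hx] at this
  simpa [sub_eq_zero, h] using this

end H2

section Poincare

variable {ℓ : ℕ} {Lbc : H2 L →L[ℝ] EuclideanSpace ℝ (Fin ℓ)}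

/-- Poincaré inequality: the `H²` norm is controlled by the second derivative and the boundary
data. -/
theorem exists_norm_le_der2_add (hL : 0 < L)
    (hdef : ∀ v : H2 L, Lbc v = 0 → ‖v.der2‖ = 0 → v = 0) :
    ∃ C, 0 ≤ C ∧ ∀ v : H2 L, ‖v‖ ≤ C * (‖v.der2‖ + ‖Lbc v‖) := by
  -- An affine curve with zero boundary data vanishes by `hdef`, so L_bc is injective on the
  -- finite-dimensional space of affine curves and bounded below there.
  have hker : ((Lbc.comp (H2.affineCLM hL)) : E3 × E3 →ₗ[ℝ] EuclideanSpace ℝ (Fin ℓ)).ker = ⊥ := by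
    rw [LinearMap.ker_eq_bot']
    intro p hp
    have hz := hdef (H2.affineCLM hL p) hp (by rw [H2.der2_affine, norm_zero])
    have h1 := H2.val_affine_zero hL p
    have h2 := H2.der_affine hL p (H2.zero_mem hL)
    rw [hz, ← H2.valCLM_apply hL (H2.zero_mem hL), map_zero] at h1
    rw [hz, ← H2.derCLM_apply hL (H2.zero_mem hL), map_zero] at h2
    exact Prod.ext h1.symm h2.symm
  obtain ⟨K, -, hK⟩ := LinearMap.exists_antilipschitzWith _ hker
  have hK' : ∀ p, ‖p‖ ≤ K * ‖Lbc (H2.affineCLM hL p)‖ := fun p => by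
    simpa using hK.le_mul_dist p 0
  set R : L2 L →L[ℝ] H2 L := (H2.ofInitialCLM hL).comp
    ((ContinuousLinearMap.inr ℝ E3 (E3 × L2 L)).comp (ContinuousLinearMap.inr ℝ E3 (L2 L))) with hR
  set P := H2.affineCLM hL with hP
  -- The affine curve with the initial data of v, plus a curve with zero initial data. The second
  -- part is controlled by v''; the first by its boundary data, which are those of v minus those of
  -- the second part.
  have hdec : ∀ v : H2 L, v = P (v.val 0, v.der 0) + R v.der2 := fun v => by
    have h : ((v.val 0, v.der 0, v.der2) : E3 × E3 × L2 L)
        = (v.val 0, v.der 0, 0) + (0, 0, v.der2) := by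
      simp only [Prod.mk_add_mk, add_zero, zero_add]
    conv_lhs => rw [← H2.ofInitial_self hL v, h]
    exact (H2.ofInitialCLM hL).map_add _ _
  refine ⟨‖P‖ * (K * (1 + ‖Lbc‖ * ‖R‖)) + ‖R‖, by positivity, fun v => ?_⟩
  set p := (v.val 0, v.der 0) with hp
  have h1 : ‖Lbc (P p)‖ ≤ ‖Lbc v‖ + ‖Lbc‖ * ‖R‖ * ‖v.der2‖ := by
    have e : Lbc (P p) = Lbc v - Lbc (R v.der2) := by
      conv_rhs => rw [hdec v, map_add]
      rw [← hp]
      have hd2 : (P p + R v.der2).der2 = v.der2 := by rw [hp, ← hdec v]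
      rw [hd2, add_sub_cancel_right]
    rw [e]
    refine (norm_sub_le _ _).trans (add_le_add le_rfl ?_)
    rw [mul_assoc]
    exact (Lbc.le_opNorm _).trans (mul_le_mul_of_nonneg_left (R.le_opNorm _) Lbc.opNorm_nonneg)
  have h2 : ‖v‖ ≤ ‖P‖ * ‖p‖ + ‖R‖ * ‖v.der2‖ := by
    calc ‖v‖ = ‖P p + R v.der2‖ := by rw [hp, ← hdec v]
      _ ≤ _ := (norm_add_le _ _).trans (add_le_add (P.le_opNorm _) (R.le_opNorm _))
  have h3 : ‖p‖ ≤ K * (1 + ‖Lbc‖ * ‖R‖) * (‖v.der2‖ + ‖Lbc v‖) := by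
    refine (hK' p).trans ?_
    rw [mul_assoc]
    refine mul_le_mul_of_nonneg_left (h1.trans ?_) K.2
    have := mul_nonneg (mul_nonneg (norm_nonneg Lbc) (norm_nonneg R)) (norm_nonneg (Lbc v))
    nlinarith [norm_nonneg v.der2]
  calc ‖v‖ ≤ ‖P‖ * ‖p‖ + ‖R‖ * ‖v.der2‖ := h2
    _ ≤ ‖P‖ * (K * (1 + ‖Lbc‖ * ‖R‖) * (‖v.der2‖ + ‖Lbc v‖)) + ‖R‖ * (‖v.der2‖ + ‖Lbc v‖) := by
      gcongr
      linarith [norm_nonneg (Lbc v)]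
    _ = _ := by ring

/-- For fixed `γ < 1` the energy controls the `H²` norm of curves with given boundary data. -/
theorem exists_norm_le_of_stabilizedIntegral_le (hL : 0 < L)
    (hdef : ∀ v : H2 L, Lbc v = 0 → ‖v.der2‖ = 0 → v = 0)
    {Φ : E3 → ℝ} (hΦ : ContDiff ℝ 1 Φ) (b : EuclideanSpace ℝ (Fin ℓ)) {γ : ℝ} (h0 : 0 ≤ γ)
    (h1 : γ < 1) (c : ℝ) :
    ∃ M : ℝ, ∀ u : H2 L, Lbc u = b → stabilizedIntegral Φ γ u ≤ c → ‖u‖ ≤ M := by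
  obtain ⟨C, hC0, hC⟩ := exists_norm_le_der2_add hL hdef
  refine ⟨C * (√(c / ((1 - γ) / 2)) + ‖b‖), fun u hu hc => ?_⟩
  have h2 : 0 < (1 - γ) / 2 := by linarith
  have h3 := norm_sq_le_stabilizedForm h0 (norm_normalComponent_le hΦ u) u.der2
  rw [← stabilizedIntegral_eq] at h3
  refine (hC u).trans ?_
  rw [hu]
  gcongr
  refine Real.le_sqrt_of_sq_le ?_
  rw [le_div_iff₀ h2, mul_comm]
  exact h3.trans hc

/-- Unit speed curves with given boundary data stay in a fixed ball. -/
theorem exists_norm_val_le_of_unit_speed (hL : 0 < L)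
    (hbdry : DependsOnBoundaryValues Lbc)
    (hdef : ∀ v : H2 L, Lbc v = 0 → ‖v.der2‖ = 0 → v = 0) (b : EuclideanSpace ℝ (Fin ℓ)) :
    ∃ R : ℝ, ∀ u : H2 L, (∀ x ∈ Icc 0 L, ‖u.der x‖ = 1) → Lbc u = b →
      ∀ x ∈ Icc 0 L, ‖u.val x‖ ≤ R := by
  have h0 := H2.zero_mem hL
  have hLL : L ∈ Icc 0 L := ⟨hL.le, le_rfl⟩
  obtain ⟨C, hC0, hC⟩ := exists_norm_le_der2_add hL hdef
  -- The endpoint traces. Since L_bc depends on nothing else, it factors through the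
  -- finite-dimensional range of D, and the factor T is automatically bounded.
  set D : H2 L →ₗ[ℝ] (E3 × E3) × (E3 × E3) :=
    (((H2.valCLM hL h0).prod (H2.valCLM hL hLL)).prod
      ((H2.derCLM hL h0).prod (H2.derCLM hL hLL))).toLinearMap with hD
  have hDapp : ∀ u : H2 L, D u = ((u.val 0, u.val L), (u.der 0, u.der L)) := fun u => rfl
  have : Module.Free ℝ D.range := Module.Free.of_divisionRing ℝ D.range
  have : Module.Projective ℝ D.range := Module.Projective.of_free
  obtain ⟨s, hs⟩ := D.rangeRestrict.exists_rightInverse_of_surjective D.range_rangeRestrict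
  set T : D.range →L[ℝ] EuclideanSpace ℝ (Fin ℓ) :=
    LinearMap.toContinuousLinearMap ((Lbc : H2 L →ₗ[ℝ] _).comp s) with hT
  have hfac : ∀ u, Lbc u = T (D.rangeRestrict u) := fun u => by
    have h1 : D.rangeRestrict (s (D.rangeRestrict u)) = D.rangeRestrict u :=
      LinearMap.congr_fun hs (D.rangeRestrict u)
    have h2 : D (s (D.rangeRestrict u)) = D u := congrArg Subtype.val h1
    rw [hDapp, hDapp, Prod.mk.injEq, Prod.mk.injEq, Prod.mk.injEq] at h2
    exact (hbdry _ _ h2.1.1 h2.1.2 h2.2.1 h2.2.2).symm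
  refine ⟨H2.embeddingConst L * (C * (‖b‖ + ‖T‖ * (L + 1))) + L, fun u hu hub x hx => ?_⟩
  have hdist : ∀ y ∈ Icc 0 L, ‖u.val y - u.val 0‖ ≤ L := fun y hy => by
    rw [H2.val_sub hL u h0 hy]
    have := intervalIntegral.norm_integral_le_of_norm_le_const (a := 0) (b := y) (f := u.der)
      (C := 1) (fun z hz => (hu z (Icc_subset_of_mem h0 hy (uIoc_subset_uIcc hz))).le)
    rw [sub_zero, abs_of_nonneg hy.1, one_mul] at this
    exact this.trans hy.2
  -- The constant curve through u(0). The traces of u - a are bounded by L + 1 because u has unit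
  -- speed, so L_bc a is bounded; as a'' = 0, the Poincaré inequality then bounds a, and with it
  -- u(0).
  set a := H2.affineCLM hL (u.val 0, 0) with ha
  have ha0 : a.val 0 = u.val 0 := H2.val_affine_zero hL _
  have had : ∀ y ∈ Icc 0 L, a.der y = 0 := fun y hy => H2.der_affine hL _ hy
  have haL : a.val L = u.val 0 := by
    have := H2.val_sub hL a h0 hLL
    rw [intervalIntegral.integral_congr (g := fun _ => 0) (fun y hy =>
      had y (Icc_subset_of_mem h0 hLL hy))] at this
    rw [intervalIntegral.integral_zero, sub_eq_zero] at this
    rw [this, ha0]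
  have hDn : ‖D (u - a)‖ ≤ L + 1 := by
    rw [map_sub, hDapp, hDapp, Prod.mk_sub_mk, Prod.mk_sub_mk, Prod.mk_sub_mk, ha0, haL,
      had 0 h0, had L hLL, sub_self, sub_zero, sub_zero]
    simp only [Prod.norm_mk, norm_zero, hu 0 h0, hu L hLL, max_self]
    have := hdist L hLL
    refine max_le (max_le (by linarith) (by linarith)) (by linarith)
  have hLa : ‖Lbc a‖ ≤ ‖b‖ + ‖T‖ * (L + 1) := by
    have e : Lbc a = b - T (D.rangeRestrict (u - a)) := by
      rw [← hfac, map_sub, hub, sub_sub_cancel]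
    rw [e]
    refine (norm_sub_le _ _).trans (add_le_add le_rfl ((T.le_opNorm _).trans ?_))
    exact mul_le_mul_of_nonneg_left hDn T.opNorm_nonneg
  have hna : ‖a‖ ≤ C * (‖b‖ + ‖T‖ * (L + 1)) := by
    refine (hC a).trans ?_
    rw [ha, H2.der2_affine, norm_zero, zero_add, ← ha]
    exact mul_le_mul_of_nonneg_left hLa hC0
  have hE : 0 ≤ H2.embeddingConst L := by unfold H2.embeddingConst; positivity
  have h1 := (H2.norm_val_le hL a h0).trans (mul_le_mul_of_nonneg_left hna hE)
  rw [ha0] at h1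
  calc ‖u.val x‖ = ‖u.val 0 + (u.val x - u.val 0)‖ := by rw [add_sub_cancel]
    _ ≤ _ := (norm_add_le _ _).trans (add_le_add h1 (hdist x hx))

end Poincare

/-! ### Partitions -/

namespace Partition

theorem z_mem (T : Partition L) (j : Fin (T.J + 1)) : T.z j ∈ Icc 0 L := by
  constructor
  · rw [← T.first]; exact T.strictMono.monotone (Fin.zero_le j)
  · exact (T.strictMono.monotone (Fin.le_last j)).trans_eq T.last

theorem z_lt (T : Partition L) (j : Fin T.J) : T.z j.castSucc < T.z j.succ :=
  T.strictMono j.castSucc_lt_succ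

theorem sub_le_meshSize (T : Partition L) (j : Fin T.J) :
    T.z j.succ - T.z j.castSucc ≤ T.meshSize :=
  le_ciSup (f := fun j : Fin T.J => T.z j.succ - T.z j.castSucc) (finite_range _).bddAbove j

theorem exists_mem_Icc (hL : 0 < L) (T : Partition L) {x : ℝ} (hx : x ∈ Icc 0 L) :
    ∃ j : Fin T.J, x ∈ Icc (T.z j.castSucc) (T.z j.succ) := by
  -- Induction on a node to the right of x. The alternative x ≤ 0 absorbs the first node, which
  -- closes no cell, and is resolved afterwards with x = 0.
  have h : ∀ k : Fin (T.J + 1), x ≤ T.z k →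
      (∃ j : Fin T.J, x ∈ Icc (T.z j.castSucc) (T.z j.succ)) ∨ x ≤ 0 := by
    intro k
    induction k using Fin.induction with
    | zero => intro h; right; rwa [T.first] at h
    | succ i ih =>
      intro h
      rcases le_total (T.z i.castSucc) x with h' | h'
      · exact Or.inl ⟨i, h', h⟩
      · exact ih h'
  rcases h (Fin.last T.J) (by rw [T.last]; exact hx.2) with h | h
  · exact h
  · have hJ : 0 < T.J := by
      rcases Nat.eq_zero_or_pos T.J with h0 | h0
      · exfalso
        have e : (0 : Fin (T.J + 1)) = Fin.last T.J := by ext; simp [h0]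
        have := T.first
        rw [e, T.last] at this
        exact hL.ne' this
      · exact h0
    have hx0 : x = 0 := le_antisymm h hx.1
    have e0 : T.z (⟨0, hJ⟩ : Fin T.J).castSucc = 0 := T.first
    refine ⟨⟨0, hJ⟩, ?_, ?_⟩
    · rw [e0, hx0]
    · rw [hx0, ← e0]; exact (T.z_lt _).le

theorem exists_node_near (hL : 0 < L) (T : Partition L) {x : ℝ} (hx : x ∈ Icc 0 L) :
    ∃ j, |T.z j - x| ≤ T.meshSize := by
  obtain ⟨j, hj⟩ := T.exists_mem_Icc hL hx
  refine ⟨j.castSucc, ?_⟩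
  have := T.sub_le_meshSize j
  rw [abs_le]
  constructor <;> linarith [hj.1, hj.2]

theorem ae_exists_mem_Ioo (hL : 0 < L) (T : Partition L) :
    ∀ᵐ x ∂(intervalMeasure L), ∃ j : Fin T.J, x ∈ Ioo (T.z j.castSucc) (T.z j.succ) := by
  have hn : ∀ᵐ x ∂(intervalMeasure L), x ∉ range T.z :=
    ae_restrict_of_ae (compl_mem_ae_iff.2 ((finite_range T.z).measure_zero volume))
  filter_upwards [hn, ae_mem_Icc] with x h1 hx
  obtain ⟨j, hj⟩ := T.exists_mem_Icc hL hx
  exact ⟨j, lt_of_le_of_ne hj.1 fun h => h1 ⟨_, h⟩, lt_of_le_of_ne hj.2 fun h => h1 ⟨_, h.symm⟩⟩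

theorem notMem_Ioo_of_ne (T : Partition L) {i j : Fin T.J} (h : i ≠ j) {x : ℝ}
    (hx : x ∈ Ioo (T.z j.castSucc) (T.z j.succ)) : x ∉ Ioo (T.z i.castSucc) (T.z i.succ) := by
  intro hx'
  rcases lt_or_gt_of_ne h with h | h
  · have : T.z i.succ ≤ T.z j.castSucc := T.strictMono.monotone (Fin.succ_le_castSucc_iff.2 h)
    linarith [hx.1, hx'.2]
  · have : T.z j.succ ≤ T.z i.castSucc := T.strictMono.monotone (Fin.succ_le_castSucc_iff.2 h)
    linarith [hx.2, hx'.1]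

end Partition

/-! ### Piecewise affine functions and Hermite interpolation -/

/-- The piecewise affine function with coefficients `p`. -/
def piecewiseAffine (T : Partition L) (p : Fin T.J → E3 × E3) (x : ℝ) : E3 :=
  ∑ j, (Ioo (T.z j.castSucc) (T.z j.succ)).indicator (fun x => (p j).1 + x • (p j).2) x

theorem piecewiseAffine_of_mem (T : Partition L) (p : Fin T.J → E3 × E3) {j : Fin T.J} {x : ℝ}
    (hx : x ∈ Ioo (T.z j.castSucc) (T.z j.succ)) :
    piecewiseAffine T p x = (p j).1 + x • (p j).2 := by
  rw [piecewiseAffine, Finset.sum_eq_single j, indicator_of_mem hx]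
  · intro i _ hi
    exact indicator_of_notMem (T.notMem_Ioo_of_ne hi hx) _
  · simp

theorem memLp_piecewiseAffine (T : Partition L) (p : Fin T.J → E3 × E3) :
    MemLp (piecewiseAffine T p) 2 (intervalMeasure L) := by
  have h : MemLp (fun x => ∑ j, (Ioo (T.z j.castSucc) (T.z j.succ)).indicator
      (fun x => (p j).1 + x • (p j).2) x) 2 (intervalMeasure L) :=
    memLp_finsetSum _ fun j _ => MemLp.indicator measurableSet_Ioo
      (memLp_of_continuousOn (by fun_prop))
  exact h

/-- The space of piecewise affine functions, parametrized by the coefficients. -/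
def piecewiseAffineLp (T : Partition L) : (Fin T.J → E3 × E3) →ₗ[ℝ] L2 L where
  toFun p := (memLp_piecewiseAffine T p).toLp _
  map_add' p q := by
    rw [← MemLp.toLp_add]
    congr 1
    ext1 x
    simp only [piecewiseAffine, Pi.add_apply, Prod.fst_add, Prod.snd_add]
    rw [← Finset.sum_add_distrib]
    refine Finset.sum_congr rfl fun j _ => ?_
    by_cases hx : x ∈ Ioo (T.z j.castSucc) (T.z j.succ)
    · simp only [indicator_of_mem hx, smul_add]; abel
    · simp only [indicator_of_notMem hx, add_zero]
  map_smul' r p := by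
    rw [RingHom.id_apply, ← MemLp.toLp_const_smul]
    congr 1
    ext1 x
    simp only [piecewiseAffine, Pi.smul_apply, Prod.smul_fst, Prod.smul_snd]
    rw [Finset.smul_sum]
    refine Finset.sum_congr rfl fun j _ => ?_
    rw [← indicator_const_smul_apply]
    congr 1
    ext1 y
    rw [smul_add, smul_comm y r]

theorem coeFn_piecewiseAffineLp (T : Partition L) (p : Fin T.J → E3 × E3) :
    piecewiseAffineLp T p =ᵐ[intervalMeasure L] piecewiseAffine T p :=
  (memLp_piecewiseAffine T p).coeFn_toLp

/-- The range is finite-dimensional, so it admits orthogonal projection. -/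
theorem exists_piecewiseAffine_projection (T : Partition L) (f : L2 L) :
    ∃ p, ∀ q, inner ℝ (piecewiseAffineLp T q) (f - piecewiseAffineLp T p) = 0 := by
  obtain ⟨y, ⟨p, rfl⟩, z, hz, hf⟩ :=
    (LinearMap.range (piecewiseAffineLp T)).exists_add_mem_mem_orthogonal f
  refine ⟨p, fun q => ?_⟩
  rw [hf, add_sub_cancel_left]
  exact hz _ ⟨q, rfl⟩

theorem norm_sub_le_of_orthogonal {H : Type*} [NormedAddCommGroup H] [InnerProductSpace ℝ H]
    {f w k : H} (h : inner ℝ (w - k) (f - w) = 0) : ‖f - w‖ ≤ ‖f - k‖ := by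
  have e : f - k = (w - k) + (f - w) := by abel
  have h1 := norm_add_sq_real (w - k) (f - w)
  rw [h, ← e] at h1
  refine le_of_sq_le_sq ?_ (norm_nonneg _)
  nlinarith [sq_nonneg ‖w - k‖]

/-- The orthogonality of `g` to the piecewise affine functions, expressed by moments. -/
theorem moments_of_orthogonal {T : Partition L} {g : L2 L}
    (h : ∀ q, inner ℝ (piecewiseAffineLp T q) g = 0) (j : Fin T.J) :
    (∫ t in (T.z j.castSucc)..(T.z j.succ), g t) = 0 ∧
      (∫ t in (T.z j.castSucc)..(T.z j.succ), t • g t) = 0 := by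
  set s := Ioo (T.z j.castSucc) (T.z j.succ) with hs
  have hsub : s ⊆ Ioo 0 L := Ioo_subset_Ioo (T.z_mem _).1 (T.z_mem _).2
  have hg : IntegrableOn g s volume := IntegrableOn.mono_set (integrable_L2 g) hsub
  have hg' : IntegrableOn (fun t => t • g t) s volume := by
    rw [← integrableOn_Icc_iff_integrableOn_Ioo] at hg ⊢
    exact hg.continuousOn_smul continuousOn_id isCompact_Icc
  -- Testing with the function that equals a + t b on the cell j and zero elsewhere. Afterwards a or
  -- b is taken to be the moment itself.
  have key : ∀ a b : E3, inner ℝ a (∫ t in s, g t) + inner ℝ b (∫ t in s, t • g t) = 0 := by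
    intro a b
    have hq := h (Pi.single j (a, b))
    rw [L2.inner_def] at hq
    have e : ∫ x, inner ℝ (piecewiseAffineLp T (Pi.single j (a, b)) x) (g x) ∂(intervalMeasure L)
        = ∫ x in Ioo 0 L, s.indicator (fun x => inner ℝ a (g x) + inner ℝ b (x • g x)) x := by
      refine integral_congr_ae ?_
      filter_upwards [coeFn_piecewiseAffineLp T (Pi.single j (a, b))] with x hx
      rw [hx]
      by_cases hxs : x ∈ s
      · rw [piecewiseAffine_of_mem T _ hxs, indicator_of_mem hxs, Pi.single_eq_same,
          inner_add_left, real_inner_smul_left, real_inner_smul_right]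
      · rw [indicator_of_notMem hxs, piecewiseAffine, Finset.sum_eq_zero, inner_zero_left]
        intro i _
        by_cases hij : i = j
        · subst hij; exact indicator_of_notMem hxs _
        · rw [Pi.single_eq_of_ne hij]
          simp
    rw [e, setIntegral_indicator measurableSet_Ioo, inter_eq_right.2 hsub,
      integral_add (hg.const_inner a) (hg'.const_inner b), integral_inner hg,
      integral_inner hg'] at hq
    exact hq
  rw [intervalIntegral.integral_of_le (T.z_lt j).le, integral_Ioc_eq_integral_Ioo,
    intervalIntegral.integral_of_le (T.z_lt j).le, integral_Ioc_eq_integral_Ioo]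
  constructor
  · have := key (∫ t in s, g t) 0
    rwa [inner_zero_left, add_zero, inner_self_eq_zero] at this
  · have := key 0 (∫ t in s, t • g t)
    rwa [inner_zero_left, zero_add, inner_self_eq_zero] at this

/-- Piecewise affine projections converge in `L²` as the mesh is refined. -/
theorem tendsto_piecewiseAffine_projection (hL : 0 < L) {T : ℕ → Partition L}
    (hT : Tendsto (fun n => (T n).meshSize) atTop (𝓝 0)) (f : L2 L)
    {p : ∀ n, Fin (T n).J → E3 × E3}
    (hp : ∀ n q, inner ℝ (piecewiseAffineLp (T n) q) (f - piecewiseAffineLp (T n) (p n)) = 0) :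
    Tendsto (fun n => piecewiseAffineLp (T n) (p n)) atTop (𝓝 f) := by
  rw [Metric.tendsto_atTop]
  intro ε hε
  -- The two errors below add up to at most ε' + √L ε' = ε / 2.
  set ε' := ε / (2 * (1 + √L)) with hε'
  have hs := Real.sqrt_nonneg L
  have hε'0 : 0 < ε' := by positivity
  obtain ⟨G, -, hG1, hG2, hG3⟩ := (Lp.memLp f).exists_hasCompactSupport_eLpNorm_sub_le
    (by norm_num) (ε := ENNReal.ofReal ε') (by simpa using hε'0)
  have hfG : ‖f - hG3.toLp G‖ ≤ ε' := by
    rw [Lp.norm_def]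
    refine ENNReal.toReal_le_of_le_ofReal hε'0.le ?_
    refine le_trans (le_of_eq (eLpNorm_congr_ae ?_)) hG1
    filter_upwards [Lp.coeFn_sub f (hG3.toLp G), hG3.coeFn_toLp] with x h1 h2
    rw [h1, Pi.sub_apply, h2, Pi.sub_apply]
  have huc := isCompact_Icc.uniformContinuousOn_of_continuous (hG2.continuousOn (s := Icc 0 L))
  obtain ⟨δ, hδ, hGδ⟩ := Metric.uniformContinuousOn_iff_le.1 huc ε' hε'0
  obtain ⟨n₀, hn₀⟩ := Metric.tendsto_atTop.1 hT δ hδ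
  refine ⟨n₀, fun n hn => ?_⟩
  have hmesh : (T n).meshSize < δ := by
    have := hn₀ n hn
    rw [Real.dist_eq, sub_zero] at this
    exact (le_abs_self _).trans_lt this
  -- The piecewise constant function with the values of G at the left endpoints. It suffices as a
  -- competitor because the projection is a best approximation.
  set k := piecewiseAffineLp (T n) (fun j => (G ((T n).z j.castSucc), 0)) with hk
  have hGk : ‖hG3.toLp G - k‖ ≤ √L * ε' := by
    have h1 := Lp.norm_le_of_ae_bound (f := hG3.toLp G - k) hε'0.le (by
      filter_upwards [Lp.coeFn_sub (hG3.toLp G) k, hG3.coeFn_toLp, (T n).ae_exists_mem_Ioo hL,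
        coeFn_piecewiseAffineLp (T n) (fun j => (G ((T n).z j.castSucc), 0)), ae_mem_Icc]
        with x h1 h2 h3 h4 hx
      obtain ⟨j, hj⟩ := h3
      rw [h1, Pi.sub_apply, h2, h4, piecewiseAffine_of_mem _ _ hj]
      simp only [smul_zero, add_zero]
      rw [← dist_eq_norm]
      refine hGδ x hx _ ((T n).z_mem _) ?_
      rw [Real.dist_eq, abs_of_pos (sub_pos.2 hj.1)]
      linarith [(T n).sub_le_meshSize j, hj.2])
    refine h1.trans (le_of_eq ?_)
    have e : (measureUnivNNReal (intervalMeasure L) : ℝ) = L := by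
      change (intervalMeasure L).real univ = L
      simp [Measure.real, hL.le]
    simp [e, Real.sqrt_eq_rpow]
  have hbest : ‖f - piecewiseAffineLp (T n) (p n)‖ ≤ ‖f - k‖ := by
    refine norm_sub_le_of_orthogonal ?_
    rw [hk, ← map_sub]
    exact hp n _
  rw [dist_comm, dist_eq_norm]
  have h2 : ‖f - k‖ ≤ ‖f - hG3.toLp G‖ + ‖hG3.toLp G - k‖ := norm_sub_le_norm_sub_add_norm_sub ..
  have h3 : ε' * (1 + √L) = ε / 2 := by rw [hε']; field_simp
  nlinarith

namespace H2

/-- Integration by parts: the derivative of `x ↦ x u'(x)`. -/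
theorem smul_der_sub (hL : 0 < L) (u : H2 L) {x y : ℝ} (hx : x ∈ Icc 0 L) (hy : y ∈ Icc 0 L) :
    y • u.der y - x • u.der x = ∫ t in x..y, (u.der t + t • u.der2 t) := by
  have hc : ContinuousOn (fun t => t • u.der t) (Icc 0 L) := continuousOn_id.smul u.continuousOn_der
  have hm : MemLp (fun t => u.der t + t • u.der2 t) 2 (intervalMeasure L) := by
    refine (memLp_of_continuousOn u.continuousOn_der).add ?_
    refine ((Lp.memLp u.der2).const_smul L).mono
      (aestronglyMeasurable_id.smul (Lp.aestronglyMeasurable _)) ?_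
    filter_upwards [ae_mem_Icc] with t ht
    rw [Pi.smul_apply, norm_smul, norm_smul]
    refine mul_le_mul_of_nonneg_right ?_ (norm_nonneg _)
    rw [Real.norm_eq_abs, Real.norm_eq_abs, abs_of_nonneg ht.1, abs_of_pos hL]
    exact ht.2
  have hder : Integrable u.der (intervalMeasure L) :=
    (memLp_of_continuousOn u.continuousOn_der).integrable (by norm_num)
  have hwd : IsWeakDeriv L u.der u.der2 := IsWeakDeriv.congr u.2.2 u.der_ae_eq (ae_eq_refl _)
  have hw : IsWeakDeriv L (fun t => t • u.der t) (fun t => u.der t + t • u.der2 t) := by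
    intro φ h1 h2 h3
    -- The weak derivative of u' is tested with t φ(t); the product rule produces the additional
    -- term φ u'.
    have h1' : ContDiff ℝ ∞ fun t => t * φ t := contDiff_id.mul h1
    have hsub : tsupport (fun t => t * φ t) ⊆ tsupport φ := tsupport_mul_subset_right
    have h2' : HasCompactSupport fun t => t * φ t := h2.mul_left
    have hk := hwd _ h1' h2' (hsub.trans h3)
    have hd : ∀ t, deriv (fun t => t * φ t) t = φ t + t * deriv φ t := fun t => by
      have := (hasDerivAt_id' t).fun_mul
        ((h1.differentiable (by simp)).differentiableAt (x := t)).hasDerivAt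
      rw [this.deriv, one_mul]
    have c2 := h1.continuous_deriv (by simp)
    have i1 := integrable_test_smul h1.continuous h2 hder
    have i2 : Integrable (fun t => (t * deriv φ t) • u.der t) (intervalMeasure L) :=
      integrable_test_smul (continuous_id.mul c2) h2.deriv.mul_left hder
    have i3 := integrable_test_smul h1'.continuous h2' (integrable_L2 u.der2)
    simp only [hd, add_smul] at hk
    rw [integral_add i1 i2] at hk
    simp only [smul_add, smul_smul]
    simp only [mul_comm (φ _) _, mul_comm (deriv φ _) _] at hk ⊢
    rw [integral_add i1 i3, neg_add, ← hk]
    abel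
  obtain ⟨c, hcc⟩ := hw.exists_primitive
    ((memLp_of_continuousOn hc).integrable (by norm_num)) (hm.integrable (by norm_num))
  have hi : ∀ a ∈ Icc 0 L, ∀ b ∈ Icc 0 L,
      IntervalIntegrable (fun t => u.der t + t • u.der2 t) volume a b := fun a ha b hb =>
    (intervalIntegrable_der u ha hb).add
      ((intervalIntegrable_L2 u.der2 ha hb).continuousOn_smul continuousOn_id)
  have hcp : ContinuousOn (fun x => c + ∫ t in (0 : ℝ)..x, (u.der t + t • u.der2 t)) (Icc 0 L) := by
    refine (continuousOn_primitive c (hm.toLp _)).congr fun x hx => ?_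
    simp only
    rw [intervalIntegral_congr_Lp hm.coeFn_toLp (zero_mem hL) hx]
  have he := eqOn_Icc_of_ae_eq hL hc hcp hcc
  have ex := he hx
  have ey := he hy
  simp only at ex ey
  rw [ex, ey, add_sub_add_left_eq_sub,
    intervalIntegral.integral_interval_sub_left (hi _ (zero_mem hL) _ hy) (hi _ (zero_mem hL) _ hx)]

/-- If `u''` is orthogonal to the piecewise affine functions and `u`, `u'` vanish at `0`, then
they vanish at all nodes. -/
theorem nodes_eq_zero (hL : 0 < L) {T : Partition L} {u : H2 L} (h0 : u.val 0 = 0)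
    (h0' : u.der 0 = 0) (h : ∀ q, inner ℝ (piecewiseAffineLp T q) u.der2 = 0)
    (j : Fin (T.J + 1)) : u.val (T.z j) = 0 ∧ u.der (T.z j) = 0 := by
  induction j using Fin.induction with
  | zero => rw [T.first]; exact ⟨h0, h0'⟩
  | succ i ih =>
    obtain ⟨m0, m1⟩ := moments_of_orthogonal h i
    have ha := T.z_mem i.castSucc
    have hb := T.z_mem i.succ
    have hd : u.der (T.z i.succ) = 0 := by
      have := der_sub hL u ha hb
      rwa [m0, ih.2, sub_zero] at this
    refine ⟨?_, hd⟩
    -- In y u'(y) - x u'(x) = ∫ u' + ∫ t u'' the left side and the first moment vanish. What remains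
    -- is ∫ u' = 0, the increment of u over the cell.
    have h2 := smul_der_sub hL u ha hb
    rw [intervalIntegral.integral_add (intervalIntegrable_der u ha hb)
      ((intervalIntegrable_L2 u.der2 ha hb).continuousOn_smul (continuousOn_id' _)), m1, hd, ih.2,
      smul_zero, smul_zero, sub_zero, add_zero, ← val_sub hL u ha hb, ih.1, sub_zero] at h2
    exact h2.symm

/-- Curves with piecewise affine second derivative are piecewise cubic. -/
theorem mem_feSpace (hL : 0 < L) {T : Partition L} {v : H2 L} {p : Fin T.J → E3 × E3}
    (h : v.der2 = piecewiseAffineLp T p) : v ∈ feSpace T := by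
  intro j
  set a := (p j).1
  set b := (p j).2
  set z := T.z j.castSucc with hz
  have hzm : z ∈ Icc 0 L := T.z_mem _
  have hsub : Icc z (T.z j.succ) ⊆ Icc 0 L := Icc_subset_Icc hzm.1 (T.z_mem _).2
  set d := v.der z
  have hder : ∀ x ∈ Icc z (T.z j.succ), v.der x
      = d + (x - z) • a + (x ^ 2 / 2 - z ^ 2 / 2) • b := by
    intro x hx
    have e1 := der_sub hL v hzm (hsub hx)
    have e2 : ∫ t in z..x, v.der2 t = ∫ t in z..x, (a + t • b) := by
      rw [intervalIntegral.integral_of_le hx.1, intervalIntegral.integral_of_le hx.1,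
        integral_Ioc_eq_integral_Ioo, integral_Ioc_eq_integral_Ioo]
      have hs : Ioo z x ⊆ Ioo 0 L := Ioo_subset_Ioo hzm.1 (hsub hx).2
      refine integral_congr_ae ?_
      have hae := ae_restrict_of_ae_restrict_of_subset hs (coeFn_piecewiseAffineLp T p)
      filter_upwards [hae, ae_restrict_mem measurableSet_Ioo] with t ht htm
      rw [h, ht]
      exact piecewiseAffine_of_mem T p ⟨htm.1, htm.2.trans_le hx.2⟩
    have e3 : ∫ t in z..x, (a + t • b) = (x - z) • a + (x ^ 2 / 2 - z ^ 2 / 2) • b := by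
      rw [intervalIntegral.integral_add (by simp)
        (Continuous.intervalIntegrable (by fun_prop) _ _),
        intervalIntegral.integral_const, intervalIntegral.integral_smul_const, integral_id]
      congr 2
      ring
    rw [e2, e3] at e1
    rw [add_assoc, ← e1]
    abel
  -- Monomial coefficients obtained by integrating the affine function a + t b twice from the left
  -- node z, with initial slope d.
  refine ⟨![v.val z - z • d + (z ^ 2 / 2) • a + (z ^ 3 / 3) • b,
    d - z • a - (z ^ 2 / 2) • b, (1 / 2 : ℝ) • a, (1 / 6 : ℝ) • b], fun x hx => ?_⟩
  have e1 := val_sub hL v hzm (hsub hx)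
  have hF : ∀ t, HasDerivAt (fun t : ℝ => t • d + (t ^ 2 / 2 - z * t) • a
      + (t ^ 3 / 6 - z ^ 2 / 2 * t) • b)
      (d + (t - z) • a + (t ^ 2 / 2 - z ^ 2 / 2) • b) t := by
    intro t
    have h1 := (hasDerivAt_id t).smul_const d
    have h2 : HasDerivAt (fun t : ℝ => t ^ 2 / 2 - z * t) (t - z) t := by
      have := ((hasDerivAt_pow 2 t).div_const 2).sub ((hasDerivAt_id t).const_mul z)
      refine this.congr_deriv ?_
      simp
    have h3 : HasDerivAt (fun t : ℝ => t ^ 3 / 6 - z ^ 2 / 2 * t) (t ^ 2 / 2 - z ^ 2 / 2) t := by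
      have := ((hasDerivAt_pow 3 t).div_const 6).sub ((hasDerivAt_id t).const_mul (z ^ 2 / 2))
      refine this.congr_deriv ?_
      simp; ring
    have := (h1.add (h2.smul_const a)).add (h3.smul_const b)
    rw [one_smul] at this
    exact this
  have e2 : ∫ t in z..x, v.der t = ∫ t in z..x, (d + (t - z) • a + (t ^ 2 / 2 - z ^ 2 / 2) • b) := by
    refine intervalIntegral.integral_congr fun t ht => ?_
    rw [uIcc_of_le hx.1] at ht
    exact hder t ⟨ht.1, ht.2.trans hx.2⟩
  rw [e2, intervalIntegral.integral_eq_sub_of_hasDerivAt (fun t _ => hF t)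
    (Continuous.intervalIntegrable (by fun_prop) _ _), sub_eq_iff_eq_add] at e1
  rw [e1]
  simp only [Fin.sum_univ_four, Matrix.cons_val, Fin.coe_ofNat_eq_mod]
  norm_num
  module

end H2

/-- Hermite interpolants converge in `H²` as the mesh is refined. -/
theorem exists_hermite_interpolants (hL : 0 < L) {T : ℕ → Partition L}
    (hT : Tendsto (fun n => (T n).meshSize) atTop (𝓝 0)) (u : H2 L) :
    ∃ v : ℕ → H2 L, Tendsto v atTop (𝓝 u) ∧ ∀ n, v n ∈ feSpace (T n) ∧
      ∀ j, (v n).val ((T n).z j) = u.val ((T n).z j) ∧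
        (v n).der ((T n).z j) = u.der ((T n).z j) := by
  choose p hp using fun n => exists_piecewiseAffine_projection (T n) u.der2
  refine ⟨fun n => H2.ofInitialCLM hL (u.val 0, u.der 0, piecewiseAffineLp (T n) (p n)), ?_,
    fun n => ⟨H2.mem_feSpace hL (H2.der2_ofInitial hL _ _ _), fun j => ?_⟩⟩
  · have h1 := tendsto_piecewiseAffine_projection hL hT u.der2 hp
    have h2 : Tendsto (fun n => ((u.val 0, u.der 0, piecewiseAffineLp (T n) (p n)) : E3 × E3 × L2 L))
        atTop (𝓝 (u.val 0, u.der 0, u.der2)) :=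
      tendsto_const_nhds.prodMk_nhds (tendsto_const_nhds.prodMk_nhds h1)
    have h3 := ((H2.ofInitialCLM hL).continuous.tendsto _).comp h2
    rw [H2.ofInitial_self] at h3
    exact h3
  · set v := H2.ofInitialCLM hL (u.val 0, u.der 0, piecewiseAffineLp (T n) (p n)) with hv
    have z0 := H2.zero_mem hL
    have hval : ∀ x (hx : x ∈ Icc 0 L), (u - v).val x = u.val x - v.val x := fun x hx =>
      map_sub (H2.valCLM hL hx) u v
    have hder : ∀ x (hx : x ∈ Icc 0 L), (u - v).der x = u.der x - v.der x := fun x hx =>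
      map_sub (H2.derCLM hL hx) u v
    -- The difference u - v has zero initial data, and its second derivative is a projection error,
    -- so its nodal data vanish.
    have h := H2.nodes_eq_zero hL (T := T n) (u := u - v)
      (by rw [hval 0 z0, hv, H2.val_ofInitial_zero, sub_self])
      (by rw [hder 0 z0, hv, H2.der_ofInitial_zero, sub_self]) (hp n) j
    rw [hval _ ((T n).z_mem j), hder _ ((T n).z_mem j), sub_eq_zero, sub_eq_zero] at h
    exact ⟨h.1.symm, h.2.symm⟩

/-! ### Differentiability of curves -/

namespace H2

theorem hasDerivAt_val (hL : 0 < L) (u : H2 L) {x : ℝ} (hx : x ∈ Ioo 0 L) :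
    HasDerivAt u.val (u.der x) x := by
  have hxI := Ioo_subset_Icc_self hx
  have hnhds : Icc 0 L ∈ 𝓝 x := Icc_mem_nhds hx.1 hx.2
  have h1 : HasDerivAt (fun y => ∫ t in (0 : ℝ)..y, u.der t) (u.der x) x :=
    intervalIntegral.integral_hasDerivAt_right (intervalIntegrable_der u (zero_mem hL) hxI)
      ((u.continuousOn_der.mono Ioo_subset_Icc_self).stronglyMeasurableAtFilter isOpen_Ioo x hx)
      (u.continuousOn_der.continuousAt hnhds)
  refine (h1.const_add (u.val 0)).congr_of_eventuallyEq ?_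
  filter_upwards [hnhds] with y hy
  exact val_eq hL u hy

/-- Lebesgue differentiation of the primitive of u''. -/
theorem ae_hasDerivAt_der (hL : 0 < L) (u : H2 L) :
    ∀ᵐ x ∂(intervalMeasure L), HasDerivAt u.der (u.der2 x) x := by
  have hLL : L ∈ Icc 0 L := ⟨hL.le, le_rfl⟩
  have h := (intervalIntegrable_L2 u.der2 (zero_mem hL) hLL).ae_hasDerivAt_integral
  filter_upwards [ae_restrict_of_ae h, ae_restrict_mem measurableSet_Ioo] with x h1 hx
  rw [uIcc_of_le hL.le] at h1
  have h2 := h1 (Ioo_subset_Icc_self hx) 0 (zero_mem hL)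
  refine (h2.const_add (u.der 0)).congr_of_eventuallyEq ?_
  filter_upwards [Icc_mem_nhds hx.1 hx.2] with y hy
  exact der_eq hL u hy

end H2

/-! ### The normal field and the Weingarten map -/

section Surface

variable {Φ : E3 → ℝ} {p : E3}

theorem inner_gradient (Φ : E3 → ℝ) (p τ : E3) : inner ℝ (gradient Φ p) τ = fderiv ℝ Φ p τ :=
  InnerProductSpace.toDual_symm_apply

theorem contDiffAt_gradient (h2 : ContDiffAt ℝ 2 Φ p) : ContDiffAt ℝ 1 (gradient Φ) p := by
  have h1 : ContDiffAt ℝ 1 (fderiv ℝ Φ) p := h2.fderiv_right (by norm_num)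
  rw [contDiffAt_euclidean]
  intro i
  have e : (fun q => gradient Φ q i) = fun q => fderiv ℝ Φ q (EuclideanSpace.single i 1) := by
    ext1 q
    rw [← inner_gradient, EuclideanSpace.inner_single_right]
    simp
  rw [e]
  exact h1.clm_apply contDiffAt_const

theorem contDiffAt_inv_norm_gradient (h2 : ContDiffAt ℝ 2 Φ p) (hp : gradient Φ p ≠ 0) :
    ContDiffAt ℝ 1 (fun q => ‖gradient Φ q‖⁻¹) p :=
  ((contDiffAt_gradient h2).norm ℝ hp).inv (norm_ne_zero_iff.2 hp)

theorem contDiffAt_unitNormal (h2 : ContDiffAt ℝ 2 Φ p) (hp : gradient Φ p ≠ 0) :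
    ContDiffAt ℝ 1 (unitNormal Φ) p :=
  (contDiffAt_inv_norm_gradient h2 hp).smul (contDiffAt_gradient h2)

theorem inner_fderiv_gradient (h2 : ContDiffAt ℝ 2 Φ p) (τ σ : E3) :
    inner ℝ (fderiv ℝ (gradient Φ) p τ) σ = fderiv ℝ (fderiv ℝ Φ) p τ σ := by
  have hg := ((contDiffAt_gradient h2).differentiableAt (by norm_num)).hasFDerivAt
  have h1 : ContDiffAt ℝ 1 (fderiv ℝ Φ) p := h2.fderiv_right (by norm_num)
  have hf := (h1.differentiableAt (by norm_num)).hasFDerivAt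
  have e1 := hg.inner ℝ (hasFDerivAt_const σ p)
  have e2 := hf.clm_apply (hasFDerivAt_const σ p)
  have e3 : (fun q => inner ℝ (gradient Φ q) σ) = fun q => fderiv ℝ Φ q σ :=
    funext fun q => inner_gradient Φ q σ
  rw [e3] at e1
  have := congrArg (fun A : E3 →L[ℝ] ℝ => A τ) (e1.unique e2)
  simpa using this

/-- By the product rule, differentiating the factor ‖Φ'‖⁻¹ contributes a multiple of Φ', which is
orthogonal to σ. -/
theorem inner_fderiv_unitNormal (h2 : ContDiffAt ℝ 2 Φ p) (hp : gradient Φ p ≠ 0) (τ : E3) {σ : E3}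
    (hσ : inner ℝ (gradient Φ p) σ = 0) :
    inner ℝ (fderiv ℝ (unitNormal Φ) p τ) σ
      = ‖gradient Φ p‖⁻¹ * fderiv ℝ (fderiv ℝ Φ) p τ σ := by
  have h3 := ((contDiffAt_inv_norm_gradient h2 hp).differentiableAt (by norm_num)).hasFDerivAt
  have h4 := ((contDiffAt_gradient h2).differentiableAt (by norm_num)).hasFDerivAt
  have e : fderiv ℝ (unitNormal Φ) p = _ := (h3.fun_smul h4).fderiv
  rw [e, ← inner_fderiv_gradient h2]
  simp [inner_add_left, real_inner_smul_left, hσ]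

/-- Symmetry of the second derivative of Φ. -/
theorem inner_fderiv_unitNormal_comm (h2 : ContDiffAt ℝ 2 Φ p) (hp : gradient Φ p ≠ 0) {τ σ : E3}
    (hτ : inner ℝ (gradient Φ p) τ = 0) (hσ : inner ℝ (gradient Φ p) σ = 0) :
    inner ℝ (fderiv ℝ (unitNormal Φ) p τ) σ = inner ℝ (fderiv ℝ (unitNormal Φ) p σ) τ := by
  rw [inner_fderiv_unitNormal h2 hp τ hσ, inner_fderiv_unitNormal h2 hp σ hτ,
    (h2.isSymmSndFDerivAt (by simp)) τ σ]

theorem norm_unitNormal_eq {q : E3} (hq : gradient Φ q ≠ 0) : ‖unitNormal Φ q‖ = 1 := by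
  rw [unitNormal, norm_smul, norm_inv, norm_norm, inv_mul_cancel₀ (norm_ne_zero_iff.2 hq)]

/-- Obtained by differentiating |n_S|² = 1, which holds near p. It makes the Weingarten map preserve
the tangent plane. -/
theorem inner_gradient_fderiv_unitNormal (hΦ : ContDiff ℝ 1 Φ) (h2 : ContDiffAt ℝ 2 Φ p)
    (hp : gradient Φ p ≠ 0) (τ : E3) :
    inner ℝ (gradient Φ p) (fderiv ℝ (unitNormal Φ) p τ) = 0 := by
  have hn := ((contDiffAt_unitNormal h2 hp).differentiableAt (by norm_num)).hasFDerivAt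
  have e1 := hn.inner ℝ hn
  have hev : (fun q => inner ℝ (unitNormal Φ q) (unitNormal Φ q)) =ᶠ[𝓝 p] fun _ => (1 : ℝ) := by
    filter_upwards [(continuous_gradient hΦ).continuousAt.eventually_ne hp] with q hq
    rw [real_inner_self_eq_norm_sq, norm_unitNormal_eq hq, one_pow]
  have e2 := (hasFDerivAt_const (𝕜 := ℝ) (1 : ℝ) p).congr_of_eventuallyEq hev
  have h := congrArg (fun A : E3 →L[ℝ] ℝ => A τ) (e1.unique e2)
  simp only [ContinuousLinearMap.comp_apply, ContinuousLinearMap.prod_apply, fderivInnerCLM_apply, zero_apply] at h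
  rw [real_inner_comm (unitNormal Φ p)] at h
  have h' : inner ℝ (unitNormal Φ p) (fderiv ℝ (unitNormal Φ) p τ) = 0 := by linarith
  rw [unitNormal, real_inner_smul_left] at h'
  exact (mul_eq_zero.1 h').resolve_left (inv_ne_zero (norm_ne_zero_iff.2 hp))

/-- If a symmetric operator has all eigenvalues at most `c`, then its quadratic form is at most
`c ‖x‖²`. -/
theorem inner_le_of_eigenvalues_le {V : Type*} [NormedAddCommGroup V] [InnerProductSpace ℝ V]
    [FiniteDimensional ℝ V] {W : V →ₗ[ℝ] V} (hW : W.IsSymmetric) {c : ℝ}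
    (hc : ∀ μ, Module.End.HasEigenvalue W μ → μ ≤ c) (x : V) : inner ℝ (W x) x ≤ c * ‖x‖ ^ 2 := by
  rcases eq_or_ne x 0 with rfl | hx
  · simp
  have : Nontrivial V := ⟨x, 0, hx⟩
  have hpos : ∀ y : V, y ≠ 0 → 0 < ‖y‖ ^ 2 := fun y hy => by positivity
  have hb : BddAbove (range fun y : { y : V // y ≠ 0 } => inner ℝ (W y) (y : V) / ‖(y : V)‖ ^ 2) := by
    refine ⟨‖LinearMap.toContinuousLinearMap W‖, ?_⟩
    rintro _ ⟨y, rfl⟩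
    simp only
    rw [div_le_iff₀ (hpos y y.2), pow_two, ← mul_assoc]
    refine (real_inner_le_norm _ _).trans ?_
    exact mul_le_mul_of_nonneg_right ((LinearMap.toContinuousLinearMap W).le_opNorm y)
      (norm_nonneg _)
  -- In finite dimension the supremum of the Rayleigh quotient is an eigenvalue.
  have h1 := hc _ hW.hasEigenvalue_iSup_of_finiteDimensional
  have h2 := (le_ciSup hb ⟨x, hx⟩).trans h1
  rwa [div_le_iff₀ (hpos x hx)] at h2

/-- The Weingarten map on the tangent plane. -/
def weingarten (hΦ : ContDiff ℝ 1 Φ) (h2 : ContDiffAt ℝ 2 Φ p) (hp : gradient Φ p ≠ 0) :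
    (ℝ ∙ gradient Φ p)ᗮ →ₗ[ℝ] (ℝ ∙ gradient Φ p)ᗮ :=
  LinearMap.codRestrict _ ((-(fderiv ℝ (unitNormal Φ) p)).toLinearMap.comp (Submodule.subtype _))
    fun τ => by
      rw [Submodule.mem_orthogonal_singleton_iff_inner_right]
      simp [inner_gradient_fderiv_unitNormal hΦ h2 hp]

theorem coe_weingarten (hΦ : ContDiff ℝ 1 Φ) (h2 : ContDiffAt ℝ 2 Φ p) (hp : gradient Φ p ≠ 0)
    (τ : (ℝ ∙ gradient Φ p)ᗮ) :
    (weingarten hΦ h2 hp τ : E3) = -(fderiv ℝ (unitNormal Φ) p τ) := rfl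

theorem isSymmetric_weingarten (hΦ : ContDiff ℝ 1 Φ) (h2 : ContDiffAt ℝ 2 Φ p)
    (hp : gradient Φ p ≠ 0) : (weingarten hΦ h2 hp).IsSymmetric := by
  intro τ σ
  have hτ := Submodule.mem_orthogonal_singleton_iff_inner_right.1 τ.2
  have hσ := Submodule.mem_orthogonal_singleton_iff_inner_right.1 σ.2
  rw [Submodule.coe_inner, Submodule.coe_inner, coe_weingarten, coe_weingarten, inner_neg_left,
    inner_neg_right, inner_fderiv_unitNormal_comm h2 hp hτ hσ, real_inner_comm]

theorem isPrincipalCurvature_of_hasEigenvalue (hΦ : ContDiff ℝ 1 Φ) (h2 : ContDiffAt ℝ 2 Φ p)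
    (hp : gradient Φ p ≠ 0) {μ : ℝ} (hμ : Module.End.HasEigenvalue (weingarten hΦ h2 hp) μ) :
    IsPrincipalCurvature Φ p μ := by
  obtain ⟨τ, hτ⟩ := hμ.exists_hasEigenvector
  refine ⟨τ, fun h => hτ.2 (Subtype.ext h), Submodule.mem_orthogonal_singleton_iff_inner_right.1 τ.2, ?_⟩
  have := congrArg Subtype.val hτ.apply_eq_smul
  rwa [coe_weingarten] at this

/-- The second fundamental form is bounded by the principal curvatures. -/
theorem abs_inner_fderiv_unitNormal_le (hΦ : ContDiff ℝ 1 Φ) (h2 : ContDiffAt ℝ 2 Φ p)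
    (hp : gradient Φ p ≠ 0) {c : ℝ} (hc : ∀ κ, IsPrincipalCurvature Φ p κ → |κ| ≤ c) {τ : E3}
    (hτ : inner ℝ (gradient Φ p) τ = 0) (hτ1 : ‖τ‖ = 1) :
    |inner ℝ (fderiv ℝ (unitNormal Φ) p τ) τ| ≤ c := by
  set t : (ℝ ∙ gradient Φ p)ᗮ :=
    ⟨τ, Submodule.mem_orthogonal_singleton_iff_inner_right.2 hτ⟩ with ht
  have hsym := isSymmetric_weingarten hΦ h2 hp
  have htn : ‖t‖ = 1 := hτ1
  have e : inner ℝ (weingarten hΦ h2 hp t) t = -inner ℝ (fderiv ℝ (unitNormal Φ) p τ) τ := by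
    rw [Submodule.coe_inner, coe_weingarten, inner_neg_left]
  have h3 := inner_le_of_eigenvalues_le hsym (c := c)
    (fun μ hμ => (le_abs_self μ).trans (hc μ (isPrincipalCurvature_of_hasEigenvalue hΦ h2 hp hμ))) t
  have hneg : (-weingarten hΦ h2 hp).IsSymmetric := fun x y => by
    rw [LinearMap.neg_apply, LinearMap.neg_apply, inner_neg_left, inner_neg_right, hsym x y]
  -- The lower bound comes from the negated operator, whose eigenvalues are the negatives of
  -- principal curvatures.
  have h4 := inner_le_of_eigenvalues_le hneg (c := c) (fun μ hμ => by
    obtain ⟨v, hv⟩ := hμ.exists_hasEigenvector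
    have hv' : weingarten hΦ h2 hp v = (-μ) • v := by
      have := hv.apply_eq_smul
      rw [LinearMap.neg_apply] at this
      rw [neg_smul, ← this, neg_neg]
    have := hc _ (isPrincipalCurvature_of_hasEigenvalue hΦ h2 hp
      (Module.End.hasEigenvalue_of_hasEigenvector
        (Module.End.hasEigenvector_iff.2 ⟨Module.End.mem_eigenspace_iff.2 hv', hv.2⟩)))
    rw [abs_neg] at this
    exact (le_abs_self μ).trans this) t
  rw [LinearMap.neg_apply, inner_neg_left, e, htn] at h4
  rw [e, htn] at h3
  rw [abs_le]
  constructor <;> linarith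

end Surface

/-! ### Curves on the surface -/

section Curves

variable {Φ : E3 → ℝ} {u : H2 L}

theorem IsArclengthCurveOn.norm_der (hu : IsArclengthCurveOn Φ u) {x : ℝ} (hx : x ∈ Icc 0 L) :
    ‖u.der x‖ = 1 := by
  have := (hu x hx).2
  rwa [pow_eq_one_iff_of_nonneg (norm_nonneg _) two_ne_zero] at this

theorem IsArclengthCurveOn.inner_gradient_der (hL : 0 < L) (hΦ : ContDiff ℝ 1 Φ)
    (hu : IsArclengthCurveOn Φ u) {x : ℝ} (hx : x ∈ Ioo 0 L) :
    inner ℝ (gradient Φ (u.val x)) (u.der x) = 0 := by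
  rw [inner_gradient]
  have h1 := ((hΦ.differentiable (by norm_num)).differentiableAt (x := u.val x)).hasFDerivAt
    |>.comp_hasDerivAt x (H2.hasDerivAt_val hL u hx)
  have h2 : HasDerivAt (Φ ∘ u.val) 0 x := by
    refine (hasDerivAt_const x (0 : ℝ)).congr_of_eventuallyEq ?_
    filter_upwards [Icc_mem_nhds hx.1 hx.2] with y hy using (hu y hy).1
  exact h1.unique h2

/-- The normal curvature of a curve on the surface is given by the second fundamental form. -/
theorem IsArclengthCurveOn.ae_inner_der2_unitNormal (hL : 0 < L) (hΦ : ContDiff ℝ 1 Φ)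
    (hreg : ∀ p, Φ p = 0 → gradient Φ p ≠ 0) (h2 : ∀ p, Φ p = 0 → ContDiffAt ℝ 2 Φ p)
    (hu : IsArclengthCurveOn Φ u) : ∀ᵐ x ∂(intervalMeasure L),
      inner ℝ (u.der2 x) (unitNormal Φ (u.val x))
        = -inner ℝ (fderiv ℝ (unitNormal Φ) (u.val x) (u.der x)) (u.der x) := by
  filter_upwards [H2.ae_hasDerivAt_der hL u, ae_restrict_mem measurableSet_Ioo] with x h1 hx
  have h0 := (hu x (Ioo_subset_Icc_self hx)).1
  have hn := ((contDiffAt_unitNormal (h2 _ h0) (hreg _ h0)).differentiableAt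
    (by norm_num)).hasFDerivAt.comp_hasDerivAt x (H2.hasDerivAt_val hL u hx)
  have h3 := hn.inner ℝ h1
  -- Tangency of u' makes n_S(u) · u' vanish near x, while its derivative is n_S(u) · u'' +
  -- Dn_S(u)u' · u'.
  have h4 : HasDerivAt (fun y => inner ℝ ((unitNormal Φ ∘ u.val) y) (u.der y)) 0 x := by
    refine (hasDerivAt_const x (0 : ℝ)).congr_of_eventuallyEq ?_
    filter_upwards [Ioo_mem_nhds hx.1 hx.2] with y hy
    rw [Function.comp_apply, unitNormal, real_inner_smul_left, hu.inner_gradient_der hL hΦ hy,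
      mul_zero]
  have h5 := h3.unique h4
  rw [Function.comp_apply] at h5
  rw [real_inner_comm]
  linarith

theorem IsArclengthCurveOn.ae_norm_sq_der2_le (hL : 0 < L) (hΦ : ContDiff ℝ 1 Φ)
    (hreg : ∀ p, Φ p = 0 → gradient Φ p ≠ 0) (h2 : ∀ p, Φ p = 0 → ContDiffAt ℝ 2 Φ p) {c : ℝ}
    (hc : ∀ p κ, Φ p = 0 → IsPrincipalCurvature Φ p κ → |κ| ≤ c)
    (hu : IsArclengthCurveOn Φ u) : ∀ᵐ x ∂(intervalMeasure L),
      ‖u.der2 x‖ ^ 2 ≤ geodesicCurvatureSq Φ u x + c ^ 2 := by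
  filter_upwards [hu.ae_inner_der2_unitNormal hL hΦ hreg h2,
    ae_restrict_mem measurableSet_Ioo] with x h1 hx
  have hxI := Ioo_subset_Icc_self hx
  have h0 := (hu x hxI).1
  have h3 := abs_inner_fderiv_unitNormal_le hΦ (h2 _ h0) (hreg _ h0) (fun κ => hc _ κ h0)
    (hu.inner_gradient_der hL hΦ hx) (hu.norm_der hxI)
  rw [geodesicCurvatureSq, h1, abs_neg]
  have := pow_le_pow_left₀ (abs_nonneg _) h3 2
  linarith

/-- The normal curvature of curves in a bounded part of the surface is bounded. -/
theorem exists_abs_inner_der2_unitNormal_le (hL : 0 < L) (hΦ : ContDiff ℝ 1 Φ)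
    (hreg : ∀ p, Φ p = 0 → gradient Φ p ≠ 0) (h2 : ∀ p, Φ p = 0 → ContDiffAt ℝ 2 Φ p) (R : ℝ) :
    ∃ C : ℝ, ∀ u : H2 L, IsArclengthCurveOn Φ u → (∀ x ∈ Icc 0 L, ‖u.val x‖ ≤ R) →
      ∀ᵐ x ∂(intervalMeasure L), |inner ℝ (u.der2 x) (unitNormal Φ (u.val x))| ≤ C := by
  -- The part of the surface in the ball is compact, and Dn_S is continuous at its points, hence
  -- bounded on it.
  have hK : IsCompact (Metric.closedBall (0 : E3) R ∩ Φ ⁻¹' {0}) :=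
    (isCompact_closedBall _ _).inter_right (isClosed_singleton.preimage hΦ.continuous)
  obtain ⟨C, hC⟩ := hK.exists_bound_of_continuousOn (f := fderiv ℝ (unitNormal Φ)) (fun p hp =>
    ((contDiffAt_unitNormal (h2 p hp.2) (hreg p hp.2)).fderiv_right (m := 0)
      (by norm_num)).continuousAt.continuousWithinAt)
  refine ⟨C, fun u hu hR => ?_⟩
  filter_upwards [hu.ae_inner_der2_unitNormal hL hΦ hreg h2, ae_mem_Icc] with x h1 hx
  rw [h1, abs_neg]
  refine (abs_real_inner_le_norm _ _).trans ?_
  rw [hu.norm_der hx, mul_one]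
  have := (fderiv ℝ (unitNormal Φ) (u.val x)).le_opNorm (u.der x)
  rw [hu.norm_der hx, mul_one] at this
  exact this.trans (hC _ ⟨mem_closedBall_zero_iff.2 (hR x hx), (hu x hx).1⟩)

/-- The geodesic curvature energy controls the `H²` norm of arclength curves on the surface with
given boundary data. -/
theorem exists_norm_le_of_isArclengthCurveOn (hL : 0 < L) (hΦ : ContDiff ℝ 1 Φ)
    (hreg : ∀ p, Φ p = 0 → gradient Φ p ≠ 0) (h2 : ∀ p, Φ p = 0 → ContDiffAt ℝ 2 Φ p)
    {ℓ : ℕ} {Lbc : H2 L →L[ℝ] EuclideanSpace ℝ (Fin ℓ)} (hbdry : DependsOnBoundaryValues Lbc)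
    (hdef : ∀ v : H2 L, Lbc v = 0 → ‖v.der2‖ = 0 → v = 0) (b : EuclideanSpace ℝ (Fin ℓ)) (c : ℝ) :
    ∃ M : ℝ, ∀ γ : ℝ, 0 ≤ γ → γ ≤ 1 → ∀ u ∈ admissible Φ Lbc b,
      stabilizedIntegral Φ γ u ≤ c → ‖u‖ ≤ M := by
  obtain ⟨R, hR⟩ := exists_norm_val_le_of_unit_speed hL hbdry hdef b
  obtain ⟨C, hC⟩ := exists_abs_inner_der2_unitNormal_le hL hΦ hreg h2 R
  obtain ⟨D, hD0, hD⟩ := exists_norm_le_der2_add hL hdef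
  refine ⟨D * (√(2 * c + (√L * |C|) ^ 2) + ‖b‖), fun γ h0 h1 u hu hc => ?_⟩
  have hQ : ‖normalComponent hΦ u u.der2‖ ≤ √L * |C| := by
    have h := Lp.norm_le_of_ae_bound (f := normalComponent hΦ u u.der2) (abs_nonneg C) (by
      filter_upwards [hC u hu.1 (hR u (fun x hx => hu.1.norm_der hx) hu.2),
        coeFn_fieldComponent (aestronglyMeasurable_normal hΦ u)
          (fun _ => norm_unitNormal_le Φ _) u.der2] with x h3 h4
      rw [normalComponent, h4]
      exact h3.trans (le_abs_self C))
    refine h.trans (le_of_eq ?_)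
    have e : (measureUnivNNReal (intervalMeasure L) : ℝ) = L := by
      change (intervalMeasure L).real univ = L
      simp [Measure.real, hL.le]
    simp [e, Real.sqrt_eq_rpow]
  rw [stabilizedIntegral_eq hΦ, stabilizedForm] at hc
  have h5 : ‖normalComponent hΦ u u.der2‖ ^ 2 ≤ (√L * |C|) ^ 2 :=
    pow_le_pow_left₀ (norm_nonneg _) hQ 2
  refine (hD u).trans ?_
  rw [hu.2]
  gcongr
  refine Real.le_sqrt_of_sq_le ?_
  -- From ‖u''‖² ≤ 2c + γ‖Q u''‖², the condition γ ≤ 1 removes γ and makes the bound uniform.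
  nlinarith [mul_nonneg (sub_nonneg.2 h1) (sq_nonneg ‖normalComponent hΦ u u.der2‖)]

end Curves

/-! ### The constraint sets -/

section Constraints

variable {Φ : E3 → ℝ} {ℓ : ℕ} {Lbc : H2 L →L[ℝ] EuclideanSpace ℝ (Fin ℓ)}
  {b : EuclideanSpace ℝ (Fin ℓ)}

theorem energy_eq_constrainedEnergy (γ : ℝ) :
    energy Φ Lbc b γ = constrainedEnergy (admissible Φ Lbc b) Φ γ := rfl

theorem discreteEnergy_eq_constrainedEnergy (γ : ℝ) (T : Partition L) :
    discreteEnergy Φ Lbc b γ T = constrainedEnergy (discreteAdmissible Φ Lbc b T) Φ γ := rfl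

theorem gradient_ne_zero_of_mem_admissible (hreg : ∀ p, Φ p = 0 → gradient Φ p ≠ 0) :
    ∀ u ∈ admissible Φ Lbc b, ∀ x ∈ Icc 0 L, gradient Φ (u.val x) ≠ 0 :=
  fun _ hu x hx => hreg _ (hu.1 x hx).1

/-- Weak limits are admissible if the constraints hold at points converging to any given point. -/
theorem mem_admissible_of_weaklyConverges (hL : 0 < L) (hΦ : Continuous Φ) {u : ℕ → H2 L}
    {u₀ : H2 L} (hu : WeaklyConverges u u₀) (hb : ∀ n, Lbc (u n) = b)
    (hy : ∀ x ∈ Icc 0 L, ∃ y : ℕ → ℝ, (∀ n, y n ∈ Icc 0 L) ∧ Tendsto y atTop (𝓝 x) ∧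
      ∀ n, Φ ((u n).val (y n)) = 0 ∧ ‖(u n).der (y n)‖ ^ 2 = 1) :
    u₀ ∈ admissible Φ Lbc b := by
  refine ⟨fun x hx => ?_, ?_⟩
  · obtain ⟨y, hyI, hyx, hyc⟩ := hy x hx
    have h1 := H2.tendsto_apply_seq (H2.tendstoUniformlyOn_val hL hu) u₀.continuousOn_val hx hyI hyx
    have h2 := H2.tendsto_apply_seq (H2.tendstoUniformlyOn_der hL hu) u₀.continuousOn_der hx hyI hyx
    have h3 := (hΦ.tendsto _).comp h1
    have h4 := h2.norm.pow 2
    simp only [Function.comp_def, fun n => (hyc n).1] at h3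
    simp only [fun n => (hyc n).2] at h4
    exact ⟨tendsto_nhds_unique h3 tendsto_const_nhds, tendsto_nhds_unique h4 tendsto_const_nhds⟩
  · have h := (hu.map Lbc).tendsto_euclidean
    simp only [hb] at h
    exact tendsto_nhds_unique h tendsto_const_nhds

theorem weaklyClosedInLimit_admissible (hL : 0 < L) (hΦ : Continuous Φ) :
    WeaklyClosedInLimit (fun _ => admissible Φ Lbc b) (admissible Φ Lbc b) :=
  fun _ _ _ _ hu hw => mem_admissible_of_weaklyConverges hL hΦ hw (fun n => (hu n).2)
    fun x hx => ⟨fun _ => x, fun _ => hx, tendsto_const_nhds, fun n => (hu n).1 x hx⟩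

/-- Each point of [0, L] has a node within the mesh size, so by uniform convergence the nodal
constraints hold everywhere in the limit. -/
theorem weaklyClosedInLimit_discreteAdmissible (hL : 0 < L) (hΦ : Continuous Φ)
    {T : ℕ → Partition L} (hT : Tendsto (fun n => (T n).meshSize) atTop (𝓝 0)) :
    WeaklyClosedInLimit (fun n => discreteAdmissible Φ Lbc b (T n)) (admissible Φ Lbc b) := by
  intro φ u u₀ hφ hu hw
  refine mem_admissible_of_weaklyConverges hL hΦ hw (fun n => (hu n).2.2) fun x hx => ?_
  choose j hj using fun n => (T (φ n)).exists_node_near hL hx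
  refine ⟨fun n => (T (φ n)).z (j n), fun n => (T (φ n)).z_mem _, ?_,
    fun n => ⟨((hu n).2.1 (j n)).2, ((hu n).2.1 (j n)).1⟩⟩
  rw [tendsto_iff_norm_sub_tendsto_zero]
  exact squeeze_zero (fun _ => norm_nonneg _) hj (hT.comp hφ)

/-- Hermite interpolants inherit the constraints at the nodes, and also the boundary data, since 0
and L are nodes. -/
theorem exists_recovery_discreteAdmissible (hL : 0 < L) (hbdry : DependsOnBoundaryValues Lbc)
    {T : ℕ → Partition L} (hT : Tendsto (fun n => (T n).meshSize) atTop (𝓝 0)) :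
    ∀ u ∈ admissible Φ Lbc b, ∃ v : ℕ → H2 L,
      (∀ n, v n ∈ discreteAdmissible Φ Lbc b (T n)) ∧ Tendsto v atTop (𝓝 u) := by
  intro u hu
  obtain ⟨v, hv, hvT⟩ := exists_hermite_interpolants hL hT u
  refine ⟨v, fun n => ⟨(hvT n).1, fun j => ?_, ?_⟩, hv⟩
  · rw [((hvT n).2 j).1, ((hvT n).2 j).2]
    exact (hu.1 _ ((T n).z_mem j)).symm
  · have h0 := (hvT n).2 0
    have h1 := (hvT n).2 (Fin.last (T n).J)
    rw [(T n).first] at h0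
    simp only [(T n).last] at h1
    rw [← hu.2]
    exact hbdry _ _ h0.1 h1.1 h0.2 h1.2

end Constraints

end ElasticCurves

end

/-! ### Assembly of the two limits and the curvature bound -/

theorem mainTheorem5 {L : ℝ} (hL : 0 < L)
    (Φ : ElasticCurves.E3 → ℝ) (hΦ : ContDiff ℝ 1 Φ)
    (hreg : ∀ p, Φ p = 0 → gradient Φ p ≠ 0)
    {ℓ : ℕ} (Lbc : ElasticCurves.H2 L →L[ℝ] EuclideanSpace ℝ (Fin ℓ))
    (b : EuclideanSpace ℝ (Fin ℓ))
    (hbdry : ElasticCurves.DependsOnBoundaryValues Lbc)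
    (hdef : ∀ v : ElasticCurves.H2 L, Lbc v = 0 → ‖v.der2‖ = 0 → v = 0)
    (hne : (ElasticCurves.admissible Φ Lbc b).Nonempty)
    (hdens : ElasticCurves.admissible Φ Lbc b ⊆
      closure (ElasticCurves.admissible Φ Lbc b ∩ ElasticCurves.sobolevH3 L)) :
    -- discretization: `h → 0` for fixed `γ`
    (∀ γ : ℝ, 0 < γ → γ < 1 → ∀ T : ℕ → ElasticCurves.Partition L,
      Tendsto (fun n => (T n).meshSize) atTop (𝓝 0) →
        ElasticCurves.GammaConverges
          (fun n => ElasticCurves.discreteEnergy Φ Lbc b γ (T n))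
          (ElasticCurves.energy Φ Lbc b γ) ∧
        ElasticCurves.BoundedEnergyCompact
          (fun n => ElasticCurves.discreteEnergy Φ Lbc b γ (T n))
          (ElasticCurves.energy Φ Lbc b γ) ∧
        ElasticCurves.QuasiMinimizersConverge
          (fun n => ElasticCurves.discreteEnergy Φ Lbc b γ (T n))
          (ElasticCurves.energy Φ Lbc b γ)) ∧
    -- vanishing stabilization: `γ → 1`
    (∀ γ : ℕ → ℝ, (∀ n, 0 < γ n ∧ γ n < 1) → Tendsto γ atTop (𝓝 1) →
      ElasticCurves.GammaConverges
        (fun n => ElasticCurves.energy Φ Lbc b (γ n)) (ElasticCurves.energy Φ Lbc b 1) ∧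
      ElasticCurves.QuasiMinimizersConverge
        (fun n => ElasticCurves.energy Φ Lbc b (γ n)) (ElasticCurves.energy Φ Lbc b 1) ∧
      ((∀ p, Φ p = 0 → ContDiffAt ℝ 2 Φ p) →
        ElasticCurves.BoundedEnergyCompact
          (fun n => ElasticCurves.energy Φ Lbc b (γ n)) (ElasticCurves.energy Φ Lbc b 1))) ∧
    -- the curvature bound `|u''|² ≤ κ_g² + c_S²`
    ((∀ p, Φ p = 0 → ContDiffAt ℝ 2 Φ p) →
      ∀ c : ℝ, (∀ p κ, Φ p = 0 → ElasticCurves.IsPrincipalCurvature Φ p κ → |κ| ≤ c) →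
        ∀ u : ElasticCurves.H2 L, ElasticCurves.IsArclengthCurveOn Φ u →
          ∀ᵐ x ∂(ElasticCurves.intervalMeasure L),
            ‖u.der2 x‖ ^ 2 ≤ ElasticCurves.geodesicCurvatureSq Φ u x + c ^ 2) := by
  have hregA := ElasticCurves.gradient_ne_zero_of_mem_admissible (Lbc := Lbc) (b := b) hreg
  refine ⟨fun γ h0 h1 T hT => ?_, fun γ h01 hγ => ?_, fun h2 c hc u hu =>
    hu.ae_norm_sq_der2_le hL hΦ hreg h2 hc⟩
  · simp only [ElasticCurves.discreteEnergy_eq_constrainedEnergy,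
      ElasticCurves.energy_eq_constrainedEnergy]
    have hcl := ElasticCurves.weaklyClosedInLimit_discreteAdmissible (Lbc := Lbc) (b := b) hL
      hΦ.continuous hT
    have hrec := ElasticCurves.exists_recovery_discreteAdmissible (Φ := Φ) (b := b) hL hbdry hT
    have h01 : ∀ _ : ℕ, 0 ≤ γ ∧ γ ≤ 1 := fun _ => ⟨h0.le, h1.le⟩
    refine ⟨ElasticCurves.gammaConverges_constrainedEnergy hL hΦ h01 tendsto_const_nhds hregA
        hcl hrec,
      ElasticCurves.boundedEnergyCompact_constrainedEnergy hL hΦ h01 tendsto_const_nhds hregA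
        hcl fun c => ?_,
      ElasticCurves.quasiMinimizersConverge_constrainedEnergy hL hΦ h01 tendsto_const_nhds hregA
        hcl hrec hne⟩
    obtain ⟨M, hM⟩ :=
      ElasticCurves.exists_norm_le_of_stabilizedIntegral_le hL hdef hΦ b h0.le h1 c
    exact ⟨M, fun n u hu => hM u hu.2.2⟩
  · simp only [ElasticCurves.energy_eq_constrainedEnergy]
    have hcl := ElasticCurves.weaklyClosedInLimit_admissible (Lbc := Lbc) (b := b) hL
      hΦ.continuous
    -- The constraint set does not change with γ, so constant sequences serve for recovery.
    have hrec : ∀ u ∈ ElasticCurves.admissible Φ Lbc b, ∃ v : ℕ → ElasticCurves.H2 L,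
        (∀ n : ℕ, v n ∈ ElasticCurves.admissible Φ Lbc b) ∧ Tendsto v atTop (𝓝 u) :=
      fun u hu => ⟨fun _ => u, fun _ => hu, tendsto_const_nhds⟩
    have h01' : ∀ n, 0 ≤ γ n ∧ γ n ≤ 1 := fun n => ⟨(h01 n).1.le, (h01 n).2.le⟩
    refine ⟨ElasticCurves.gammaConverges_constrainedEnergy hL hΦ h01' hγ hregA hcl hrec,
      ElasticCurves.quasiMinimizersConverge_constrainedEnergy hL hΦ h01' hγ hregA hcl hrec hne,
      fun h2 => ElasticCurves.boundedEnergyCompact_constrainedEnergy hL hΦ h01' hγ hregA hcl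
        fun c => ?_⟩
    -- The bound with the factor 1 - γ degenerates here; the bound through the normal curvature is
    -- uniform in γ.
    obtain ⟨M, hM⟩ :=
      ElasticCurves.exists_norm_le_of_isArclengthCurveOn hL hΦ hreg h2 hbdry hdef b c
    exact ⟨M, fun n u hu => hM (γ n) (h01' n).1 (h01' n).2 u hu⟩
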